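/- \textbf{Setting.} $\mathtt{CaTT}$ is the Finster--Mimram type theory for $(\infty,\infty)$-categories, with types $\mathrm{Ob}$ and $s\to_A t$, and terms built from variables, operations $\mathrm{op}_{\Gamma,s\to_A t}[\gamma]$ and coherences $\mathrm{coh}_{\Gamma,s\to_A t}[\gamma]$ over pasting contexts $\Gamma$. Put $\dim\mathrm{Ob}=0$, $\dim(s\to_A t)=\dim A+1$, and let the dimension of a term be that of its type. For $u:s\to_A t$ write $\sigma(u)=s$, $\tau(u)=t$, and for $x:X$ with $X\equiv s\to_A t$ write $\partial X=A$. $\mathrm{FV}(t:A)=\mathrm{FV}(t)\cup\mathrm{FV}(A)$. A context is \emph{globular} if it is derivable without operations and coherences (so all terms in its types are variables). \emph{Composites and units.} For $n<d$, $u\ast_{d,n}v$ is the standard binary composite (an $\mathrm{op}$-term over the gluing of two $d$-globes along an $n$-globe) of $d$-dimensional terms with $\tau^{d-n}(u)\equiv\sigma^{d-n}(v)$. For a term $u$ with $\dim u\le d$, $1^d_u$ is the $d$-dimensional iterated unit on $u$, i.e. the $(d-\dim u)$-fold iterated identity (a $\mathrm{coh}$-term over the globe of dimension $\dim u$); it is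 $u$ itself if $\dim u=d$. \emph{Linearity.} For a variable $x$ and a term $t$, $x\propto t$ means that $x\in\mathrm{FV}(t)$, $\dim x=\dim t$, and either $t\equiv x$, or $t$ is $\mathrm{op}_{\Gamma,B}[\gamma]$ or $\mathrm{coh}_{\Gamma,B}[\gamma]$ and there is exactly one variable $y$ of $\Gamma$ with $x\propto\gamma_y$. \emph{Cones.} For a list of declarations $\Pi$ and a set $S$ of variables, let $P_\Pi(S)=\bigcup\{\mathrm{FV}(p:T_p) : (p:T_p)\in\Pi,\ y\propto\tau(p)\text{ for some }y\in S\}$. The judgment $K\ \mathtt{cone}\ (\Gamma;c)$ is generated by two rules. (EK): $(c:\mathrm{Ob})\ \mathtt{cone}\ (\emptyset;c)$. (KE): if $(\Gamma,c:\mathrm{Ob},\Pi)\ \mathtt{cone}\ (\Gamma;c)$ and $K':\equiv(\Gamma,x:X,c:\mathrm{Ob},\Pi)\vdash s\to_A t$ in $\mathtt{CaTT}$, where $$\mathrm{FV}(s:A)=\{c\}\cup P_\Pi\big(\mathrm{FV}(\tau(x):\partial X)\big),\qquad \mathrm{FV}(t:A)=\mathrm{FV}(x:X)\cup P_\Pi\big(\mathrm{FV}(\sigma(x):\partial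 X)\big),\qquad x\propto t$$ (the sets $\mathrm{FV}(\sigma(x):\partial X)$ and $\mathrm{FV}(\tau(x):\partial X)$ being empty if $X\equiv\mathrm{Ob}$), then $(K',p_x:s\to_A t)\ \mathtt{cone}\ ((\Gamma,x:X);c)$, for a fresh variable $p_x$, the projection of $x$. \textbf{Theorem.} Let $\Gamma\equiv(x_i:A_i)_{1\le i\le n}$ be a globular context. There is a context $$C(\Gamma)\equiv\Gamma,\ c:\mathrm{Ob},\ \Pi,\qquad \Pi\equiv(p_{x_i}:T_{x_i})_{1\le i\le n},$$ such that $C(\Gamma)\ \mathtt{cone}\ (\Gamma;c)$ is derivable and such that, for every $(x:A)\in\Gamma$ with $d=\dim x$, the type $T_x$ of the projection $p_x$ is $$c\to x\quad\text{if } d=0,$$ $$p_{\tau(x)}\to p_{\sigma(x)}\ast_{d,d-1}\Big(1^d_{p_{\sigma^2(x)}}\ast_{d,d-2}\cdots\Big(1^d_{p_{\sigma^d(x)}}\ast_{d,0}x\Big)\Big)\quad\text{if } d>0.$$ Moreover, for every $(x:A)\in\Gamma$, the projection satisfies $$\mathrm{FV}(p_x:T_x)=P_\Pi\big(\mathrm{FV}(x:A)\big),\qquad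 c\in\mathrm{FV}(p_x:T_x),$$ where linearity is taken in $C(\Gamma)$, and $x$ is the unique variable $y$ of $\Gamma$ with $y\propto\tau(p_x)$. -/

import Mathlib

namespace CaTT

/-! ### Raw syntax

Variables are natural numbers.  A context `Γ, x : A` is `Γ.snoc x A`, a substitution `⟨γ, t⟩` into
`Γ, x : A` is `γ.snoc x t` (it remembers which variable of the context `t` is assigned to), the type
`s →_A t` is `Ty.arr A s t`, and `op_{Γ, B}[γ]`, `coh_{Γ, B}[γ]` are `Tm.op Γ B γ`, `Tm.coh Γ B γ`
(with `B` of the form `s →_A t`). -/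

mutual
/-- Raw types. -/
inductive Ty : Type
  | ob : Ty
  | arr (A : Ty) (s t : Tm) : Ty
/-- Raw terms. -/
inductive Tm : Type
  | var (x : ℕ) : Tm
  | op (Γ : Ctx) (B : Ty) (γ : Subst) : Tm
  | coh (Γ : Ctx) (B : Ty) (γ : Subst) : Tm
/-- Raw contexts. -/
inductive Ctx : Type
  | nil : Ctx
  | snoc (Γ : Ctx) (x : ℕ) (A : Ty) : Ctx
/-- Raw substitutions (context morphisms). -/
inductive Subst : Type
  | nil : Subst
  | snoc (γ : Subst) (x : ℕ) (t : Tm) : Subst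
end

/-! ### Free variables -/

mutual
/-- `FV(A)`. -/
def Ty.fv : Ty → Finset ℕ
  | .ob => ∅
  | .arr A s t => s.fv ∪ t.fv ∪ A.fv
/-- `FV(t)`. -/
def Tm.fv : Tm → Finset ℕ
  | .var x => {x}
  | .op _ _ γ => γ.fv
  | .coh _ _ γ => γ.fv
/-- `FV(γ)`. -/
def Subst.fv : Subst → Finset ℕ
  | .nil => ∅
  | .snoc γ _ t => γ.fv ∪ t.fv
end

/-- `FV(Γ)`, the set of variables declared in `Γ`. -/
def Ctx.fv : Ctx → Finset ℕ
  | .nil => ∅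
  | .snoc Γ x _ => Γ.fv ∪ {x}

/-! ### Contexts -/

/-- `Γ.Mem x A` means `(x : A) ∈ Γ`. -/
def Ctx.Mem (x : ℕ) (A : Ty) : Ctx → Prop
  | .nil => False
  | .snoc Γ y B => (x = y ∧ A = B) ∨ Γ.Mem x A

/-- The number of variables of a context. -/
def Ctx.length : Ctx → ℕ
  | .nil => 0
  | .snoc Γ _ _ => Γ.length + 1

/-- Concatenation `Γ, Γ'`. -/
def Ctx.append (Γ : Ctx) : Ctx → Ctx
  | .nil => Γ
  | .snoc Γ' x A => (Γ.append Γ').snoc x A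

/-- The context without its last declaration. -/
def Ctx.drop : Ctx → Ctx
  | .nil => .nil
  | .snoc Γ _ _ => Γ

/-- The variables of the context are `0, 1, 2, …`, in this order. -/
def Ctx.Normal : Ctx → Prop
  | .nil => True
  | .snoc Γ x _ => Γ.Normal ∧ x = Γ.length

/-! ### Dimension -/

/-- The dimension of a type. -/
def Ty.dim : Ty → ℕ
  | .ob => 0
  | .arr A _ _ => A.dim + 1

/-- The dimension of a context: the maximum of the dimensions of its types. -/
def Ctx.dim : Ctx → ℕ
  | .nil => 0
  | .snoc Γ _ A => max Γ.dim A.dim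

/-- The dimension of a variable declared in a context, that is, of its type
(`0` if it is not declared). -/
def Ctx.varDim (x : ℕ) : Ctx → ℕ
  | .nil => 0
  | .snoc Γ y A => if x = y then A.dim else Γ.varDim x

/-! ### Substitution -/

/-- The term `γ_x` that `γ` assigns to the variable `x` (`x` itself if there is none). -/
def Subst.get (x : ℕ) : Subst → Tm
  | .nil => .var x
  | .snoc γ y t => if x = y then t else γ.get x

mutual
/-- `A[δ]`. -/
def Ty.subst : Ty → Subst → Ty
  | .ob, _ => .ob
  | .arr A s t, δ => .arr (A.subst δ) (s.subst δ) (t.subst δ)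
/-- `t[δ]`. -/
def Tm.subst : Tm → Subst → Tm
  | .var x, δ => δ.get x
  | .op Γ B γ, δ => .op Γ B (γ.comp δ)
  | .coh Γ B γ, δ => .coh Γ B (γ.comp δ)
/-- `γ ∘ δ`. -/
def Subst.comp : Subst → Subst → Subst
  | .nil, _ => .nil
  | .snoc γ x t, δ => .snoc (γ.comp δ) x (t.subst δ)
end

/-! ### Pasting contexts, their sources and targets -/

/-- `Γ ⊢ps x : A`: the rules (PSS), (PSE), (PSD). -/
inductive PsAt : Ctx → ℕ → Ty → Prop
  | pss (x : ℕ) : PsAt (Ctx.nil.snoc x .ob) x .ob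
  | pse {Γ : Ctx} {x : ℕ} {A : Ty} (y f : ℕ) :
      PsAt Γ x A → y ∉ Γ.fv → f ∉ (Γ.snoc y A).fv →
      PsAt ((Γ.snoc y A).snoc f (.arr A (.var x) (.var y))) f (.arr A (.var x) (.var y))
  | psd {Γ : Ctx} {f x y : ℕ} {A : Ty} :
      PsAt Γ f (.arr A (.var x) (.var y)) → PsAt Γ y A

/-- `Γ ⊢ps`: the rule (PS). -/
def Ps (Γ : Ctx) : Prop := ∃ x, PsAt Γ x .ob

/-- The `k`-source `∂ₖ⁻ Γ` of a pasting context. -/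
def Ctx.srcAt (k : ℕ) : Ctx → Ctx
  | .nil => .nil
  | .snoc .nil x A => .snoc .nil x A
  | .snoc (.snoc Γ y A) f B =>
      if k ≤ A.dim then Γ.srcAt k else ((Γ.srcAt k).snoc y A).snoc f B

/-- The `k`-target `∂ₖ⁺ Γ` of a pasting context. -/
def Ctx.tgtAt (k : ℕ) : Ctx → Ctx
  | .nil => .nil
  | .snoc .nil x A => .snoc .nil x A
  | .snoc (.snoc Γ y A) f B =>
      if k < A.dim then Γ.tgtAt k
      else if k = A.dim then (Γ.tgtAt k).drop.snoc y A
      else ((Γ.tgtAt k).snoc y A).snoc f B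

/-- `∂⁻ Γ` (meaningful when `dim Γ > 0`). -/
def Ctx.src (Γ : Ctx) : Ctx := Γ.srcAt (Γ.dim - 1)

/-- `∂⁺ Γ` (meaningful when `dim Γ > 0`). -/
def Ctx.tgt (Γ : Ctx) : Ctx := Γ.tgtAt (Γ.dim - 1)

/-! ### The judgments of CaTT

The variables of the pasting context `Γ` are bound in `op_{Γ,B}[γ]` and `coh_{Γ,B}[γ]`, and terms are
considered up to renaming of bound variables.  This is implemented by requiring `Γ.Normal` in (OP)
and (COH): of all renamings of `Γ`, the one with the variables `0, 1, 2, …` is used.  All other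
contexts have arbitrary, pairwise distinct variables. -/

mutual
/-- `Γ ⊢`: the rules (EC) and (CE). -/
inductive IsCtx : Ctx → Prop
  | ec : IsCtx .nil
  | ce {Γ : Ctx} {x : ℕ} {A : Ty} : IsTy Γ A → x ∉ Γ.fv → IsCtx (Γ.snoc x A)
/-- `Γ ⊢ A`. -/
inductive IsTy : Ctx → Ty → Prop
  | ob {Γ : Ctx} : IsCtx Γ → IsTy Γ .ob
  | arr {Γ : Ctx} {A : Ty} {s t : Tm} : IsTm Γ s A → IsTm Γ t A → IsTy Γ (.arr A s t)
/-- `Γ ⊢ t : A`: the rules (VAR), (OP) and (COH). -/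
inductive IsTm : Ctx → Tm → Ty → Prop
  | var {Γ : Ctx} {x : ℕ} {A : Ty} : IsCtx Γ → Γ.Mem x A → IsTm Γ (.var x) A
  | op {Γ Δ : Ctx} {A : Ty} {s t : Tm} {γ : Subst} :
      Ps Γ → Γ.Normal → 0 < Γ.dim → IsTy Γ (.arr A s t) → IsSubst Δ γ Γ →
      Γ.src.fv = s.fv ∪ A.fv → Γ.tgt.fv = t.fv ∪ A.fv →
      IsTm Δ (.op Γ (.arr A s t) γ) (.arr (A.subst γ) (s.subst γ) (t.subst γ))
  | coh {Γ Δ : Ctx} {A : Ty} {s t : Tm} {γ : Subst} :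
      Ps Γ → Γ.Normal → IsTy Γ (.arr A s t) → IsSubst Δ γ Γ →
      Γ.fv = s.fv ∪ A.fv → Γ.fv = t.fv ∪ A.fv →
      IsTm Δ (.coh Γ (.arr A s t) γ) (.arr (A.subst γ) (s.subst γ) (t.subst γ))
/-- `Δ ⊢ γ : Γ`: the rules (ES) and (SE). -/
inductive IsSubst : Ctx → Subst → Ctx → Prop
  | es {Δ : Ctx} : IsCtx Δ → IsSubst Δ .nil .nil
  | se {Δ Γ : Ctx} {γ : Subst} {x : ℕ} {A : Ty} {t : Tm} :
      IsSubst Δ γ Γ → IsCtx (Γ.snoc x A) → IsTm Δ t (A.subst γ) →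
      IsSubst Δ (γ.snoc x t) (Γ.snoc x A)
end

/-! ### The subtheory GSet: CaTT without (OP) and (COH) -/

mutual
/-- `Γ ⊢` in GSet. -/
inductive GSetCtx : Ctx → Prop
  | ec : GSetCtx .nil
  | ce {Γ : Ctx} {x : ℕ} {A : Ty} : GSetTy Γ A → x ∉ Γ.fv → GSetCtx (Γ.snoc x A)
/-- `Γ ⊢ A` in GSet. -/
inductive GSetTy : Ctx → Ty → Prop
  | ob {Γ : Ctx} : GSetCtx Γ → GSetTy Γ .ob
  | arr {Γ : Ctx} {A : Ty} {s t : Tm} : GSetTm Γ s A → GSetTm Γ t A → GSetTy Γ (.arr A s t)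
/-- `Γ ⊢ t : A` in GSet. -/
inductive GSetTm : Ctx → Tm → Ty → Prop
  | var {Γ : Ctx} {x : ℕ} {A : Ty} : GSetCtx Γ → Γ.Mem x A → GSetTm Γ (.var x) A
end

/-- A context is globular if it is derivable in GSet. -/
def Ctx.Globular (Γ : Ctx) : Prop := GSetCtx Γ

/-! ### Linear variables -/

mutual
/-- `t.Linear K x` is `x ∝ t`, for a term `t` in the context `K`: `x` has the dimension of `t`, and
either `t` is `x`, or `t` is `op_{Γ,B}[γ]` or `coh_{Γ,B}[γ]` and `x ∝ γ_i` for exactly one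
variable `i` of `Γ`. -/
def Tm.Linear (K : Ctx) (x : ℕ) : Tm → Prop
  | .var y => x = y
  | .op _ B γ => K.varDim x = B.dim ∧ γ.LinearOnce K x
  | .coh _ B γ => K.varDim x = B.dim ∧ γ.LinearOnce K x
/-- `x ∝ γ_i` for exactly one index `i`. -/
def Subst.LinearOnce (K : Ctx) (x : ℕ) : Subst → Prop
  | .nil => False
  | .snoc γ _ t => (γ.LinearOnce K x ∧ ¬ t.Linear K x) ∨ (γ.LinearNone K x ∧ t.Linear K x)
/-- `x ∝ γ_i` for no index `i`. -/
def Subst.LinearNone (K : Ctx) (x : ℕ) : Subst → Prop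
  | .nil => True
  | .snoc γ _ t => γ.LinearNone K x ∧ ¬ t.Linear K x
end

/-! ### Cones as contexts -/

/-- `FV(σ(x) : ∂X)` for a variable `x : X` (empty if `X` is `Ob`). -/
def Ty.srcFv : Ty → Finset ℕ
  | .ob => ∅
  | .arr A s _ => s.fv ∪ A.fv

/-- `FV(τ(x) : ∂X)` for a variable `x : X` (empty if `X` is `Ob`). -/
def Ty.tgtFv : Ty → Finset ℕ
  | .ob => ∅
  | .arr A _ t => t.fv ∪ A.fv

/-- The union of the sets `FV(p : T_p)` over all `(p : T_p) ∈ P` such that `y ∝ τ(p)` in the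
context `K` for some `y ∈ S`. -/
def projFv (K P : Ctx) (S : Finset ℕ) : Set ℕ :=
  {v | ∃ (p : ℕ) (A : Ty) (s t : Tm) (y : ℕ), P.Mem p (.arr A s t) ∧ y ∈ S ∧ t.Linear K y ∧
    v ∈ (Tm.var p).fv ∪ (Ty.arr A s t).fv}

/-- The side condition on the source `s : A` of the projection of `x : X`, in the context `K`. -/
def TauBarCond (K : Ctx) (s : Tm) (A X : Ty) (c : ℕ) (P : Ctx) : Prop :=
  IsTm K s A ∧ ((s.fv ∪ A.fv : Finset ℕ) : Set ℕ) = {c} ∪ projFv K P X.tgtFv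

/-- The side condition on the target `t : A` of the projection of `x : X`, in the context `K`. -/
def SigmaCond (K : Ctx) (t : Tm) (A : Ty) (x : ℕ) (X : Ty) (P : Ctx) : Prop :=
  IsTm K t A ∧
  ((t.fv ∪ A.fv : Finset ℕ) : Set ℕ) =
    (((Tm.var x).fv ∪ X.fv : Finset ℕ) : Set ℕ) ∪ projFv K P X.srcFv ∧
  t.Linear K x

/-- `Cone K Γ c` is the judgment `K cone (Γ; c)`, with the rules (EK) and (KE). -/
inductive Cone : Ctx → Ctx → ℕ → Prop
  | ek (c : ℕ) : Cone (Ctx.nil.snoc c .ob) .nil c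
  | ke {Γ P : Ctx} {x c p : ℕ} {X A : Ty} {s t : Tm} :
      Cone ((Γ.snoc c .ob).append P) Γ c →
      IsTy (((Γ.snoc x X).snoc c .ob).append P) (.arr A s t) →
      TauBarCond (((Γ.snoc x X).snoc c .ob).append P) s A X c P →
      SigmaCond (((Γ.snoc x X).snoc c .ob).append P) t A x X P →
      p ∉ (((Γ.snoc x X).snoc c .ob).append P).fv →
      Cone ((((Γ.snoc x X).snoc c .ob).append P).snoc p (.arr A s t)) (Γ.snoc x X) c

/-! ### Cells: terms together with a type -/

/-- A term together with a type, `t : A`. -/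
structure Cell where
  tm : Tm
  ty : Ty

/-- `σ(t) : ∂A` for `t : A` (`t : A` itself if `A` is `Ob`). -/
def Cell.src : Cell → Cell
  | ⟨t, .ob⟩ => ⟨t, .ob⟩
  | ⟨_, .arr A s _⟩ => ⟨s, A⟩

/-- `τ(t) : ∂A` for `t : A` (`t : A` itself if `A` is `Ob`). -/
def Cell.tgt : Cell → Cell
  | ⟨t, .ob⟩ => ⟨t, .ob⟩
  | ⟨_, .arr A _ t⟩ => ⟨t, A⟩

/-! ### Globes and gluings of two globes, as pasting contexts -/

/-- The data of a judgment `Γ ⊢ps x : A`. -/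
structure PsState where
  ctx : Ctx
  cell : Cell

/-- (PSS) -/
def PsState.pss : PsState := ⟨Ctx.nil.snoc 0 .ob, ⟨.var 0, .ob⟩⟩

/-- (PSE), with the next two numbers as new variables. -/
def PsState.pse (S : PsState) : PsState :=
  let y := S.ctx.length
  let B := Ty.arr S.cell.ty S.cell.tm (.var y)
  ⟨(S.ctx.snoc y S.cell.ty).snoc (y + 1) B, ⟨.var (y + 1), B⟩⟩

/-- (PSD) -/
def PsState.psd (S : PsState) : PsState := ⟨S.ctx, S.cell.tgt⟩

/-- The globe `D^d(x : A) ⊢ps x : A`, given by (PSS)(PSE)^d. -/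
def globe (d : ℕ) : PsState := PsState.pse^[d] PsState.pss

/-- The gluing `O^d_n(α : X, β : Y) ⊢ps β : Y` of two `d`-dimensional globes along an
`n`-dimensional one (`n < d`), given by (PSS)(PSE)^d(PSD)^(d-n)(PSE)^(d-n). The cell `α : X` is
`(globe d).cell`. -/
def glue (d n : ℕ) : PsState := PsState.pse^[d - n] (PsState.psd^[d - n] (globe d))

/-- The number of terms of a substitution. -/
def Subst.length : Subst → ℕ
  | .nil => 0
  | .snoc γ _ _ => γ.length + 1

/-- Extend a substitution whose variables are `0, 1, …` by a term for the next variable. -/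
def Subst.push (γ : Subst) (t : Tm) : Subst := γ.snoc γ.length t

/-- Extend a substitution along `m` applications of (PSE), so that the last variable is sent to
`v`: the terms `τ^m(v)`, `σ^(m-1)(v)`, …, `τ(v)`, `v` are appended. -/
def Subst.pushCell (γ : Subst) : ℕ → Cell → Subst
  | 0, _ => γ
  | m + 1, v => ((γ.pushCell m v.src).push v.tgt.tm).push v.tm

/-- The substitution into the globe `D^d` given by a `d`-dimensional cell `u`. -/
def globeSubst (d : ℕ) (u : Cell) : Subst :=
  (Subst.nil.push (Cell.src^[d] u).tm).pushCell d u

/-- The substitution into `O^d_n` given by `d`-dimensional cells `u`, `v` with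
`τ^(d-n)(u) ≡ σ^(d-n)(v)`. -/
def glueSubst (d n : ℕ) (u v : Cell) : Subst := (globeSubst d u).pushCell (d - n) v

/-! ### Binary compositions and identities -/

/-- The type `B` such that the composition `∗_{n+1+m,n}` is `op_{O^{n+1+m}_n, B}`.  For `m = 0` it is
`σ(φ) → τ(ψ)`, and for larger dimension `d` it is `σ(φ) ∗_{d-1,n} σ(ψ) → τ(φ) ∗_{d-1,n} τ(ψ)`,
where `φ`, `ψ` are the two top cells of the gluing. -/
def compTy (n : ℕ) : ℕ → Ty
  | 0 =>
      let φ := (globe (n + 1)).cell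
      let ψ := (glue (n + 1) n).cell
      .arr φ.src.ty φ.src.tm ψ.tgt.tm
  | m + 1 =>
      let d := n + 1 + m
      let φ := (globe (d + 1)).cell
      let ψ := (glue (d + 1) n).cell
      .arr ((compTy n m).subst (glueSubst d n φ.src ψ.src))
        (.op (glue d n).ctx (compTy n m) (glueSubst d n φ.src ψ.src))
        (.op (glue d n).ctx (compTy n m) (glueSubst d n φ.tgt ψ.tgt))

/-- The composite `u ∗_{d,n} v` of two `d`-dimensional cells along an `n`-dimensional one
(`n < d`), with its type. -/
def Cell.comp (d n : ℕ) (u v : Cell) : Cell :=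
  ⟨.op (glue d n).ctx (compTy n (d - n - 1)) (glueSubst d n u v),
    (compTy n (d - n - 1)).subst (glueSubst d n u v)⟩

/-- The `k`-fold iterated identity on a cell `u`, with its type: for `u` of dimension `d`, the
`(k+1)`-fold one is `coh_{D^d, w → w}[u]`, where `w` is the `k`-fold identity on the top cell of the
globe `D^d`. -/
def Cell.ident : ℕ → Cell → Cell
  | 0, u => u
  | k + 1, u =>
      let d := u.ty.dim
      let w := Cell.ident k (globe d).cell
      ⟨.coh (globe d).ctx (.arr w.ty w.tm w.tm) (globeSubst d u),
        (Ty.arr w.ty w.tm w.tm).subst (globeSubst d u)⟩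

/-- The `d`-dimensional iterated identity `1^d_u` on a cell `u` with `dim u ≤ d`
(it is `u` itself if `dim u = d`). -/
def Cell.identTo (d : ℕ) (u : Cell) : Cell := Cell.ident (d - u.ty.dim) u

/-! ### The explicit cone over a globular context -/

/-- The projection `p_y : T_y` for a term which is a variable `y`
(terms in a globular context are variables; the other cases are irrelevant). -/
def projCell (p : ℕ → ℕ) (T : ℕ → Ty) : Tm → Cell
  | .var y => ⟨.var (p y), T y⟩
  | t => ⟨t, .ob⟩

/-- For `x : A` of dimension `d`, the cell
`1^d_{p_{σ^{d-k+1}(x)}} ∗_{d,k-1} (⋯ (1^d_{p_{σ^d(x)}} ∗_{d,0} x))`, with `k` compositions. -/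
def coneTower (p : ℕ → ℕ) (T : ℕ → Ty) (d : ℕ) (x : Cell) : ℕ → Cell
  | 0 => x
  | k + 1 =>
      Cell.comp d k ((projCell p T (Cell.src^[d - k] x).tm).identTo d) (coneTower p T d x k)

/-- The type of the projection of the variable `x : A`: `c → x` if `dim A = 0`, and
`p_{τ(x)} → p_{σ(x)} ∗_{d,d-1} (1^d_{p_{σ²(x)}} ∗_{d,d-2} ⋯ (1^d_{p_{σ^d(x)}} ∗_{d,0} x))`
if `d = dim A > 0`. -/
def projTy (c : ℕ) (p : ℕ → ℕ) (T : ℕ → Ty) (x : ℕ) : Ty → Ty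
  | .ob => .arr .ob (.var c) (.var x)
  | .arr A s t =>
      .arr (projCell p T t).ty (projCell p T t).tm
        (coneTower p T (A.dim + 1) ⟨.var x, .arr A s t⟩ (A.dim + 1)).tm

/-- The list of projections `Π = (p_x : T_x)`, one for each variable `x` of `Γ`. -/
def Ctx.projections (p : ℕ → ℕ) (T : ℕ → Ty) : Ctx → Ctx
  | .nil => .nil
  | .snoc Γ x _ => (Γ.projections p T).snoc (p x) (T x)

/-- The context `Γ, c : Ob, Π` with `Π = (p_x : T_x)`. -/
def Ctx.cone (Γ : Ctx) (c : ℕ) (p : ℕ → ℕ) (T : ℕ → Ty) : Ctx :=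
  (Γ.snoc c .ob).append (Γ.projections p T)

end CaTT

/-!
Over a variable `x : A` of dimension `d`, let `Tₖ(x)` be the composite (`tower p T x k`)
`1^d_{p_{σ^{d-k+1}(x)}} ∗_{d,k-1} (⋯ (1^d_{p_{σ^d(x)}} ∗_{d,0} x))` with `k ≤ d` compositions.
The projection of `x` is `p_x : p_{τ(x)} → T_d(x)` (and `p_x : c → x` for `d = 0`), so everything
reduces to the following facts about the towers, proved by induction on `k` for all `x` at once
(`ContainsCone.towerSpec`).

* For `k < d` the boundary of a tower is a tower: `σ(Tₖ(x)) ≡ Tₖ(σ(x))` and `τ(Tₖ(x)) ≡ Tₖ(τ(x))`.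
  This holds because, syntactically, `σ(u ∗_{d,n} v) ≡ σ(u) ∗_{d-1,n} σ(v)` for `n < d - 1`, because
  the source and the target of `1^d_u` are both `1^{d-1}_u`, and because `στ ≡ σσ`.
* For `k = d > 0` the tower `T_d(x)` has the same type as `p_{τ(x)}`, so that the type of `p_x` is
  well formed.
* The next composition `1^d_{p_y} ∗_{d,k} Tₖ(x)`, with `y ≡ σ^{d-k}(x)`, is defined since
  `τ(p_y) ≡ Tₖ(y) ≡ σ^{d-k}(Tₖ(x))`.

That the composites and the units are terms at all (`isOpTy_compTy`, `Cell.ident_spec`) needs weakening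
and the substitution lemma for the theory, together with a computation of the variables of the
source and the target of the gluing of two globes (`fv_src_glue_succ`, `fv_tgt_glue_succ`).

The variables of `u ∗ v` are those of `u` and of `v`, and the ones of a unit on `u` are those of `u`.
Hence `FV(T_d(x)) = FV(x : A) ∪ FV(p_{σ(x)})` (`fv_tower`), and `FV(p_x)` contains `FV(p_y)` for all
`y ∈ FV(x : A)`. In the substitution defining `u ∗ v` only `u` and `v` have the dimension of the
composite, and a proper unit has no linear variable at all, since it is a coherence over a globe of
smaller dimension. So `x` is the only variable of `Γ` which is linear in `T_d(x)` (`linear_tower`), and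
`P_Π(FV(x : A)) = FV(p_x)` (`projFv_eq`). This gives the side conditions of the rule (KE)
(`cond_projTy`), and the cone is built by induction on `Γ` (`exists_cone`).

The facts about towers only use that the ambient context contains `Γ`, the apex and the projections
(`ContainsCone`). They thus apply both to the cone itself and to the contexts `Γ, x : X, c : Ob, Π`
of the rule (KE), in which the projection of `x` is still missing.
-/

namespace CaTT

/-! ### Free variables and substitution -/

/-- The set of variables to which a substitution assigns a term. -/
def Subst.dom : Subst → Finset ℕ
  | .nil => ∅
  | .snoc γ x _ => γ.dom ∪ {x}

mutual
theorem Ty.subst_congr {γ δ : Subst} : ∀ (A : Ty), (∀ x ∈ A.fv, γ.get x = δ.get x) →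
    A.subst γ = A.subst δ
  | .ob, _ => rfl
  | .arr A s t, h => by
      simp only [Ty.subst]
      rw [Ty.subst_congr A fun x hx => h x (by simp [Ty.fv, hx]),
        Tm.subst_congr s fun x hx => h x (by simp [Ty.fv, hx]),
        Tm.subst_congr t fun x hx => h x (by simp [Ty.fv, hx])]
theorem Tm.subst_congr {γ δ : Subst} : ∀ (t : Tm), (∀ x ∈ t.fv, γ.get x = δ.get x) →
    t.subst γ = t.subst δ
  | .var x, h => h x (by simp [Tm.fv])
  | .op Γ B θ, h => by
      simp only [Tm.subst]
      rw [Subst.comp_congr θ fun x hx => h x (by simpa [Tm.fv] using hx)]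
  | .coh Γ B θ, h => by
      simp only [Tm.subst]
      rw [Subst.comp_congr θ fun x hx => h x (by simpa [Tm.fv] using hx)]
theorem Subst.comp_congr {γ δ : Subst} : ∀ (θ : Subst), (∀ x ∈ θ.fv, γ.get x = δ.get x) →
    θ.comp γ = θ.comp δ
  | .nil, _ => rfl
  | .snoc θ y t, h => by
      simp only [Subst.comp]
      rw [Subst.comp_congr θ fun x hx => h x (by simp [Subst.fv, hx]),
        Tm.subst_congr t fun x hx => h x (by simp [Subst.fv, hx])]
end

theorem Subst.get_comp {x : ℕ} (δ : Subst) : ∀ (γ : Subst), x ∈ γ.dom →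
    (γ.comp δ).get x = (γ.get x).subst δ
  | .nil, h => by simp [Subst.dom] at h
  | .snoc γ y t, h => by
      by_cases hxy : x = y
      · simp [Subst.comp, Subst.get, hxy]
      · simp only [Subst.comp, Subst.get, hxy, if_false]
        exact Subst.get_comp δ γ (by simpa [Subst.dom, hxy] using h)

mutual
/-- Iterated substitution is substitution along the composite. The hypothesis is needed because
`Subst.get` returns the variable itself outside of the domain. -/
theorem Ty.subst_subst {γ δ : Subst} : ∀ (A : Ty), A.fv ⊆ γ.dom →
    (A.subst γ).subst δ = A.subst (γ.comp δ)
  | .ob, _ => rfl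
  | .arr A s t, h => by
      simp only [Ty.fv, Finset.union_subset_iff] at h
      simp only [Ty.subst]
      rw [Ty.subst_subst A h.2, Tm.subst_subst s h.1.1, Tm.subst_subst t h.1.2]
theorem Tm.subst_subst {γ δ : Subst} : ∀ (t : Tm), t.fv ⊆ γ.dom →
    (t.subst γ).subst δ = t.subst (γ.comp δ)
  | .var x, h => (Subst.get_comp δ γ (h (by simp [Tm.fv]))).symm
  | .op Γ B θ, h => by simp only [Tm.subst]; rw [Subst.comp_assoc θ h]
  | .coh Γ B θ, h => by simp only [Tm.subst]; rw [Subst.comp_assoc θ h]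
theorem Subst.comp_assoc {γ δ : Subst} : ∀ (θ : Subst), θ.fv ⊆ γ.dom →
    (θ.comp γ).comp δ = θ.comp (γ.comp δ)
  | .nil, _ => rfl
  | .snoc θ y t, h => by
      simp only [Subst.fv, Finset.union_subset_iff] at h
      simp only [Subst.comp]
      rw [Subst.comp_assoc θ h.1, Tm.subst_subst t h.2]
end

mutual
theorem Ty.fv_subst_subset {γ : Subst} : ∀ (A : Ty), A.fv ⊆ γ.dom → (A.subst γ).fv ⊆ γ.fv
  | .ob, _ => by simp [Ty.subst, Ty.fv]
  | .arr A s t, h => by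
      simp only [Ty.fv, Finset.union_subset_iff] at h
      simp only [Ty.subst, Ty.fv, Finset.union_subset_iff]
      exact ⟨⟨Tm.fv_subst_subset s h.1.1, Tm.fv_subst_subset t h.1.2⟩, Ty.fv_subst_subset A h.2⟩
theorem Tm.fv_subst_subset {γ : Subst} : ∀ (t : Tm), t.fv ⊆ γ.dom → (t.subst γ).fv ⊆ γ.fv
  | .var x, h => by
      have hx : x ∈ γ.dom := h (by simp [Tm.fv])
      simp only [Tm.subst]
      exact Subst.fv_get_subset γ hx
  | .op Γ B θ, h => by simp only [Tm.subst, Tm.fv]; exact Subst.fv_comp_subset θ h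
  | .coh Γ B θ, h => by simp only [Tm.subst, Tm.fv]; exact Subst.fv_comp_subset θ h
theorem Subst.fv_comp_subset {γ : Subst} : ∀ (θ : Subst), θ.fv ⊆ γ.dom → (θ.comp γ).fv ⊆ γ.fv
  | .nil, _ => by simp [Subst.comp, Subst.fv]
  | .snoc θ y t, h => by
      simp only [Subst.fv, Finset.union_subset_iff] at h
      simp only [Subst.comp, Subst.fv, Finset.union_subset_iff]
      exact ⟨Subst.fv_comp_subset θ h.1, Tm.fv_subst_subset t h.2⟩
theorem Subst.fv_get_subset {x : ℕ} : ∀ (γ : Subst), x ∈ γ.dom → (γ.get x).fv ⊆ γ.fv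
  | .nil, h => by simp [Subst.dom] at h
  | .snoc γ y t, h => by
      by_cases hxy : x = y
      · simp [Subst.get, Subst.fv, hxy]
      · simp only [Subst.get, Subst.fv, hxy, if_false]
        exact (Subst.fv_get_subset γ (by simpa [Subst.dom, hxy] using h)).trans
          Finset.subset_union_left
end

theorem Ty.dim_subst (γ : Subst) : ∀ (A : Ty), (A.subst γ).dim = A.dim
  | .ob => rfl
  | .arr A _ _ => by simp [Ty.subst, Ty.dim, Ty.dim_subst γ A]

/-! ### Structural rules -/

theorem Ctx.Mem.mem_fv {x : ℕ} {A : Ty} : ∀ {Γ : Ctx}, Γ.Mem x A → x ∈ Γ.fv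
  | .nil, h => h.elim
  | .snoc Γ y B, h => by
      rcases h with ⟨rfl, _⟩ | h
      · simp [Ctx.fv]
      · simp [Ctx.fv, Ctx.Mem.mem_fv h]


theorem Ctx.fv_subset_snoc (Γ : Ctx) (x : ℕ) (A : Ty) : Γ.fv ⊆ (Γ.snoc x A).fv :=
  Finset.subset_union_left

mutual
/-- Terms and types only use declared variables. The rule (VAR) requires the same for the types
declared in the context, so this is carried through the joint induction. -/
theorem IsCtx.fv_subset : ∀ {Γ : Ctx}, IsCtx Γ → ∀ {x : ℕ} {A : Ty}, Γ.Mem x A → A.fv ⊆ Γ.fv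
  | _, .ec, _, _, h => h.elim
  | _, .ce (Γ := Γ) hA _, _, _, h => by
      obtain ⟨h₁, h₂⟩ := hA.fv_subset
      rcases h with ⟨_, rfl⟩ | h
      · exact h₁.trans (Γ.fv_subset_snoc _ _)
      · exact (h₂ h).trans (Γ.fv_subset_snoc _ _)
theorem IsTy.fv_subset : ∀ {Γ : Ctx} {A : Ty}, IsTy Γ A →
    A.fv ⊆ Γ.fv ∧ ∀ {x : ℕ} {B : Ty}, Γ.Mem x B → B.fv ⊆ Γ.fv
  | _, _, .ob h => ⟨by simp [Ty.fv], h.fv_subset⟩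
  | _, _, .arr hs ht => by
      simp only [Ty.fv, Finset.union_subset_iff]
      exact ⟨⟨⟨hs.fv_subset.1, ht.fv_subset.1⟩, hs.fv_subset.2.1⟩, hs.fv_subset.2.2⟩
theorem IsTm.fv_subset : ∀ {Γ : Ctx} {t : Tm} {A : Ty}, IsTm Γ t A →
    t.fv ⊆ Γ.fv ∧ A.fv ⊆ Γ.fv ∧ ∀ {x : ℕ} {B : Ty}, Γ.Mem x B → B.fv ⊆ Γ.fv
  | _, _, _, .var h hx =>
      ⟨by simpa [Tm.fv] using hx.mem_fv, h.fv_subset hx, h.fv_subset⟩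
  | _, _, _, .op _ _ _ hA hγ _ _ =>
      ⟨hγ.fv_subset.1,
        (Ty.fv_subst_subset (.arr _ _ _) (hγ.fv_subset.2.1 ▸ hA.fv_subset.1)).trans
          hγ.fv_subset.1, hγ.fv_subset.2.2⟩
  | _, _, _, .coh _ _ hA hγ _ _ =>
      ⟨hγ.fv_subset.1,
        (Ty.fv_subst_subset (.arr _ _ _) (hγ.fv_subset.2.1 ▸ hA.fv_subset.1)).trans
          hγ.fv_subset.1, hγ.fv_subset.2.2⟩
theorem IsSubst.fv_subset : ∀ {Δ : Ctx} {γ : Subst} {Γ : Ctx}, IsSubst Δ γ Γ →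
    γ.fv ⊆ Δ.fv ∧ γ.dom = Γ.fv ∧ ∀ {x : ℕ} {B : Ty}, Δ.Mem x B → B.fv ⊆ Δ.fv
  | _, _, _, .es h => ⟨by simp [Subst.fv], rfl, h.fv_subset⟩
  | _, _, _, .se hγ _ ht => by
      simp only [Subst.fv, Finset.union_subset_iff, Subst.dom, Ctx.fv, hγ.fv_subset.2.1, true_and]
      exact ⟨⟨hγ.fv_subset.1, ht.fv_subset.1⟩, hγ.fv_subset.2.2⟩
end

theorem IsSubst.dom_eq {Δ Γ : Ctx} {γ : Subst} (h : IsSubst Δ γ Γ) : γ.dom = Γ.fv :=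
  h.fv_subset.2.1

mutual
theorem IsTy.isCtx : ∀ {Γ : Ctx} {A : Ty}, IsTy Γ A → IsCtx Γ
  | _, _, .ob h => h
  | _, _, .arr h _ => h.isCtx
theorem IsTm.isCtx : ∀ {Γ : Ctx} {t : Tm} {A : Ty}, IsTm Γ t A → IsCtx Γ
  | _, _, _, .var h _ => h
  | _, _, _, .op _ _ _ _ hγ _ _ => hγ.isCtx
  | _, _, _, .coh _ _ _ hγ _ _ => hγ.isCtx
theorem IsSubst.isCtx : ∀ {Δ : Ctx} {γ : Subst} {Γ : Ctx}, IsSubst Δ γ Γ → IsCtx Δ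
  | _, _, _, .es h => h
  | _, _, _, .se hγ _ _ => hγ.isCtx
end

mutual
/-- Weakening along any inclusion of declarations, so that declarations may also be inserted in the
middle of a context. -/
theorem IsTy.weaken {Δ : Ctx} (hΔ : IsCtx Δ) : ∀ {Γ : Ctx} {A : Ty}, IsTy Γ A →
    (∀ x B, Γ.Mem x B → Δ.Mem x B) → IsTy Δ A
  | _, _, .ob _, _ => .ob hΔ
  | _, _, .arr hs ht, h => .arr (hs.weaken hΔ h) (ht.weaken hΔ h)
theorem IsTm.weaken {Δ : Ctx} (hΔ : IsCtx Δ) : ∀ {Γ : Ctx} {t : Tm} {A : Ty}, IsTm Γ t A →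
    (∀ x B, Γ.Mem x B → Δ.Mem x B) → IsTm Δ t A
  | _, _, _, .var _ hx, h => .var hΔ (h _ _ hx)
  | _, _, _, .op h₁ h₂ h₃ h₄ hγ h₅ h₆, h => .op h₁ h₂ h₃ h₄ (hγ.weaken hΔ h) h₅ h₆
  | _, _, _, .coh h₁ h₂ h₃ hγ h₅ h₆, h => .coh h₁ h₂ h₃ (hγ.weaken hΔ h) h₅ h₆
theorem IsSubst.weaken {Δ : Ctx} (hΔ : IsCtx Δ) : ∀ {Γ : Ctx} {γ : Subst} {Θ : Ctx},
    IsSubst Γ γ Θ → (∀ x B, Γ.Mem x B → Δ.Mem x B) → IsSubst Δ γ Θ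
  | _, _, _, .es _, _ => .es hΔ
  | _, _, _, .se hγ h₁ ht, h => .se (hγ.weaken hΔ h) h₁ (ht.weaken hΔ h)
end

theorem IsCtx.isTy_of_mem : ∀ {Γ : Ctx}, IsCtx Γ → ∀ {x : ℕ} {A : Ty}, Γ.Mem x A → IsTy Γ A
  | _, .ec, _, _, h => h.elim
  | _, .ce hA hx, _, _, h => by
      rcases h with ⟨_, rfl⟩ | h
      · exact hA.weaken (.ce hA hx) fun _ _ => .inr
      · exact (IsCtx.isTy_of_mem hA.isCtx h).weaken (.ce hA hx) fun _ _ => .inr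

theorem IsCtx.varDim_eq : ∀ {Γ : Ctx}, IsCtx Γ → ∀ {x : ℕ} {A : Ty}, Γ.Mem x A →
    Γ.varDim x = A.dim
  | _, .ec, _, _, h => h.elim
  | _, .ce (x := z) hA hx, y, _, h => by
      rcases h with ⟨rfl, rfl⟩ | h
      · simp [Ctx.varDim]
      · have : y ≠ z := by rintro rfl; exact hx h.mem_fv
        simp only [Ctx.varDim, this, if_false]
        exact IsCtx.varDim_eq hA.isCtx h

theorem Subst.get_snoc_of_ne {γ : Subst} {x y : ℕ} {t : Tm} (h : x ≠ y) :
    (γ.snoc y t).get x = γ.get x := by simp [Subst.get, h]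

theorem Ty.subst_snoc {γ : Subst} {y : ℕ} {t : Tm} {A : Ty} (h : y ∉ A.fv) :
    A.subst (γ.snoc y t) = A.subst γ :=
  Ty.subst_congr A fun _ hx => Subst.get_snoc_of_ne fun e => h (e ▸ hx)

theorem IsSubst.isTm_get {Δ : Ctx} : ∀ {γ : Subst} {Γ : Ctx}, IsSubst Δ γ Γ →
    ∀ {x : ℕ} {A : Ty}, Γ.Mem x A → IsTm Δ (γ.get x) (A.subst γ)
  | _, _, .es _, _, _, h => h.elim
  | _, _, .se hγ hΓ ht, x, A, h => by
      cases hΓ with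
      | ce hB hy =>
        rcases h with ⟨rfl, rfl⟩ | h
        · rw [Ty.subst_snoc fun h => hy (hB.fv_subset.1 h)]
          simpa [Subst.get] using ht
        · rw [Ty.subst_snoc fun h' => hy (hB.fv_subset.2 h h'),
            Subst.get_snoc_of_ne (by rintro rfl; exact hy h.mem_fv)]
          exact IsSubst.isTm_get hγ h

mutual
/-- The substitution lemma: derivable types, terms and substitutions are stable under
substitution. -/
theorem IsTy.subst : ∀ {Γ Δ : Ctx} {A : Ty} {γ : Subst}, IsTy Γ A → IsSubst Δ γ Γ →
    IsTy Δ (A.subst γ)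
  | _, _, _, _, .ob _, hγ => .ob hγ.isCtx
  | _, _, _, _, .arr hs ht, hγ => .arr (hs.subst hγ) (ht.subst hγ)
theorem IsTm.subst : ∀ {Γ Δ : Ctx} {t : Tm} {A : Ty} {γ : Subst}, IsTm Γ t A → IsSubst Δ γ Γ →
    IsTm Δ (t.subst γ) (A.subst γ)
  | _, _, _, _, _, .var _ hx, hγ => hγ.isTm_get hx
  | _, _, _, _, _, .op h₁ h₂ h₃ h₄ hθ h₅ h₆, hγ => by
      have := IsTm.op h₁ h₂ h₃ h₄ (hθ.comp hγ) h₅ h₆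
      rw [← Ty.subst.eq_2, Ty.subst_subst (.arr _ _ _) (hθ.dom_eq ▸ h₄.fv_subset.1)]
      exact this
  | _, _, _, _, _, .coh h₁ h₂ h₄ hθ h₅ h₆, hγ => by
      have := IsTm.coh h₁ h₂ h₄ (hθ.comp hγ) h₅ h₆
      rw [← Ty.subst.eq_2, Ty.subst_subst (.arr _ _ _) (hθ.dom_eq ▸ h₄.fv_subset.1)]
      exact this
theorem IsSubst.comp : ∀ {Γ Δ Θ : Ctx} {θ γ : Subst}, IsSubst Γ θ Θ → IsSubst Δ γ Γ →
    IsSubst Δ (θ.comp γ) Θ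
  | _, _, _, _, _, .es _, hγ => .es hγ.isCtx
  | _, _, _, _, _, .se hθ hΘ ht, hγ => by
      refine .se (hθ.comp hγ) hΘ ?_
      have := ht.subst hγ
      cases hΘ with
      | ce hA _ => rwa [Ty.subst_subst _ (hθ.dom_eq ▸ hA.fv_subset.1)] at this
end

theorem IsTm.isTy {Γ : Ctx} {t : Tm} {A : Ty} : IsTm Γ t A → IsTy Γ A
  | .var h hx => h.isTy_of_mem hx
  | .op _ _ _ hA hγ _ _ => hA.subst hγ
  | .coh _ _ hA hγ _ _ => hA.subst hγ

/-- The type of an operation has no more variables than the term: both are instances of the same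
substitution. -/
theorem IsTm.ty_fv_subset_op {Δ Γ : Ctx} {A B : Ty} {γ : Subst} (h : IsTm Δ (.op Γ B γ) A) :
    A.fv ⊆ γ.fv := by
  cases h with
  | op _ _ _ hA hγ _ _ =>
    exact Ty.fv_subst_subset (.arr _ _ _) (hγ.dom_eq ▸ hA.fv_subset.1)

/-! ### Linear variables -/

/-- A linear variable of a term has the dimension of the term. -/
theorem Tm.Linear.varDim_eq {K : Ctx} {x : ℕ} {t : Tm} {A : Ty} (ht : IsTm K t A)
    (h : t.Linear K x) : K.varDim x = A.dim := by
  cases ht with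
  | var hK hx => rw [Tm.Linear] at h; exact h ▸ hK.varDim_eq hx
  | op => rw [Tm.Linear] at h; simpa [Ty.dim, Ty.dim_subst] using h.1
  | coh => rw [Tm.Linear] at h; simpa [Ty.dim, Ty.dim_subst] using h.1

theorem Subst.LinearNone.not_linearOnce {K : Ctx} {x : ℕ} : ∀ {γ : Subst}, γ.LinearNone K x →
    ¬ γ.LinearOnce K x
  | .nil, _ => by simp [Subst.LinearOnce]
  | .snoc γ y t, h => by
      simp only [Subst.LinearNone] at h
      simp [Subst.LinearOnce, h.2, Subst.LinearNone.not_linearOnce h.1]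


/-! ### Cells and their boundaries -/

/-- The action of a substitution on a cell. -/
def Cell.subst (u : Cell) (γ : Subst) : Cell := ⟨u.tm.subst γ, u.ty.subst γ⟩

/-- `FV(t : A)`. -/
def Cell.fv (u : Cell) : Finset ℕ := u.tm.fv ∪ u.ty.fv

/-- `K ⊢ t : A`. -/
def Cell.Typed (K : Ctx) (u : Cell) : Prop := IsTm K u.tm u.ty

theorem Cell.dim_src : ∀ u : Cell, u.src.ty.dim = u.ty.dim - 1
  | ⟨_, .ob⟩ => rfl
  | ⟨_, .arr _ _ _⟩ => rfl

theorem Cell.dim_tgt : ∀ u : Cell, u.tgt.ty.dim = u.ty.dim - 1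
  | ⟨_, .ob⟩ => rfl
  | ⟨_, .arr _ _ _⟩ => rfl

theorem Cell.dim_iterate_src (u : Cell) (k : ℕ) : (Cell.src^[k] u).ty.dim = u.ty.dim - k := by
  induction k generalizing u with
  | zero => rfl
  | succ k ih => rw [Function.iterate_succ_apply, ih, Cell.dim_src]; omega

theorem Cell.dim_iterate_tgt (u : Cell) (k : ℕ) : (Cell.tgt^[k] u).ty.dim = u.ty.dim - k := by
  induction k generalizing u with
  | zero => rfl
  | succ k ih => rw [Function.iterate_succ_apply, ih, Cell.dim_tgt]; omega

theorem Cell.subst_src (δ : Subst) : ∀ u : Cell, (u.subst δ).src = u.src.subst δ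
  | ⟨_, .ob⟩ => rfl
  | ⟨_, .arr _ _ _⟩ => rfl

theorem Cell.subst_tgt (δ : Subst) : ∀ u : Cell, (u.subst δ).tgt = u.tgt.subst δ
  | ⟨_, .ob⟩ => rfl
  | ⟨_, .arr _ _ _⟩ => rfl

theorem Cell.iterate_src_subst (δ : Subst) (k : ℕ) (u : Cell) :
    Cell.src^[k] (u.subst δ) = (Cell.src^[k] u).subst δ := by
  induction k generalizing u with
  | zero => rfl
  | succ k ih => simp only [Function.iterate_succ_apply, Cell.subst_src, ih]

theorem Cell.iterate_tgt_subst (δ : Subst) (k : ℕ) (u : Cell) :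
    Cell.tgt^[k] (u.subst δ) = (Cell.tgt^[k] u).subst δ := by
  induction k generalizing u with
  | zero => rfl
  | succ k ih => simp only [Function.iterate_succ_apply, Cell.subst_tgt, ih]

theorem Cell.fv_src_subset : ∀ u : Cell, u.src.fv ⊆ u.fv
  | ⟨_, .ob⟩ => subset_rfl
  | ⟨_, .arr _ _ _⟩ => by
      intro x; simp only [Cell.fv, Cell.src, Ty.fv, Finset.mem_union]; tauto

theorem Cell.fv_tgt_subset : ∀ u : Cell, u.tgt.fv ⊆ u.fv
  | ⟨_, .ob⟩ => subset_rfl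
  | ⟨_, .arr _ _ _⟩ => by
      intro x; simp only [Cell.fv, Cell.tgt, Ty.fv, Finset.mem_union]; tauto

theorem Cell.fv_iterate_tgt_subset (k : ℕ) (u : Cell) : (Cell.tgt^[k] u).fv ⊆ u.fv := by
  induction k generalizing u with
  | zero => rfl
  | succ k ih => exact (ih _).trans u.fv_tgt_subset

theorem Cell.fv_iterate_src_subset (k : ℕ) (u : Cell) : (Cell.src^[k] u).fv ⊆ u.fv := by
  induction k generalizing u with
  | zero => rfl
  | succ k ih => exact (ih _).trans u.fv_src_subset

theorem Cell.fv_eq : ∀ {u : Cell}, 0 < u.ty.dim → u.fv = u.src.fv ∪ u.tgt.tm.fv ∪ u.tm.fv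
  | ⟨_, .ob⟩, h => by simp [Ty.dim] at h
  | ⟨_, .arr _ _ _⟩, _ => by
      ext x; simp only [Cell.fv, Cell.src, Cell.tgt, Ty.fv, Finset.mem_union]; tauto

/-- The boundary of a cell of dimension at least two is globular: `σσ = στ`. -/
theorem Cell.src_tgt_eq : ∀ {u : Cell}, 2 ≤ u.ty.dim → u.tgt.src = u.src.src
  | ⟨_, .ob⟩, h => by simp [Ty.dim] at h
  | ⟨_, .arr .ob _ _⟩, h => by simp [Ty.dim] at h
  | ⟨_, .arr (.arr _ _ _) _ _⟩, _ => rfl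

/-- The boundary of a cell of dimension at least two is globular: `τσ = ττ`. -/
theorem Cell.tgt_src_eq : ∀ {u : Cell}, 2 ≤ u.ty.dim → u.src.tgt = u.tgt.tgt
  | ⟨_, .ob⟩, h => by simp [Ty.dim] at h
  | ⟨_, .arr .ob _ _⟩, h => by simp [Ty.dim] at h
  | ⟨_, .arr (.arr _ _ _) _ _⟩, _ => rfl

theorem Cell.Typed.src {K : Ctx} : ∀ {u : Cell}, u.Typed K → u.src.Typed K
  | ⟨_, .ob⟩, h => h
  | ⟨_, .arr _ _ _⟩, h => by
      cases IsTm.isTy h with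
      | arr hs ht => exact hs

theorem Cell.Typed.tgt {K : Ctx} : ∀ {u : Cell}, u.Typed K → u.tgt.Typed K
  | ⟨_, .ob⟩, h => h
  | ⟨_, .arr _ _ _⟩, h => by
      cases IsTm.isTy h with
      | arr hs ht => exact ht

theorem Cell.Typed.iterate_src {K : Ctx} {u : Cell} (h : u.Typed K) (k : ℕ) :
    (Cell.src^[k] u).Typed K := by
  induction k generalizing u with
  | zero => exact h
  | succ k ih => exact ih h.src

theorem Cell.Typed.fv_subset {K : Ctx} {u : Cell} (h : u.Typed K) : u.fv ⊆ K.fv :=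
  Finset.union_subset (IsTm.fv_subset h).1 (IsTm.fv_subset h).2.1

/-! ### Pasting contexts -/

/-- All terms of the type are variables. -/
def Ty.AllVar : Ty → Prop
  | .ob => True
  | .arr A s t => A.AllVar ∧ ∃ x y, s = .var x ∧ t = .var y

theorem PsAt.allVar {Γ : Ctx} {x : ℕ} {A : Ty} (h : PsAt Γ x A) : A.AllVar := by
  induction h with
  | pss => trivial
  | pse y f h _ _ ih => exact ⟨ih, _, _, rfl, rfl⟩
  | psd _ ih => exact ih.1

theorem PsAt.ps {Γ : Ctx} : ∀ {A : Ty} {x : ℕ}, PsAt Γ x A → Ps Γ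
  | .ob, x, h => ⟨x, h⟩
  | .arr A s t, x, h => by
      obtain ⟨-, a, b, rfl, rfl⟩ := h.allVar
      exact PsAt.ps h.psd

theorem PsAt.isTm {Γ : Ctx} {x : ℕ} {A : Ty} (h : PsAt Γ x A) : IsTm Γ (.var x) A := by
  induction h with
  | pss x => exact .var (.ce (.ob .ec) (by simp [Ctx.fv])) (.inl ⟨rfl, rfl⟩)
  | @pse Γ x A y f h hy hf ih =>
    have h₁ : IsCtx (Γ.snoc y A) := .ce ih.isTy hy
    have h₂ : IsTy (Γ.snoc y A) (.arr A (.var x) (.var y)) :=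
      .arr (ih.weaken h₁ fun _ _ => .inr) (.var h₁ (.inl ⟨rfl, rfl⟩))
    exact .var (.ce h₂ hf) (.inl ⟨rfl, rfl⟩)
  | psd _ ih =>
    cases ih.isTy with
    | arr _ ht => exact ht

theorem Ctx.Normal.fv_eq : ∀ {Γ : Ctx}, Γ.Normal → Γ.fv = Finset.range Γ.length
  | .nil, _ => rfl
  | .snoc Γ x A, h => by
      rw [Ctx.fv, Ctx.Normal.fv_eq h.1, Ctx.length, h.2, Finset.range_add_one, Finset.union_comm]
      rfl

/-- The state is a derivable judgment `Γ ⊢ps x : A`, with `Γ` normal. -/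
structure PsState.Valid (S : PsState) : Prop where
  normal : S.ctx.Normal
  psAt : ∃ x, S.cell.tm = .var x ∧ PsAt S.ctx x S.cell.ty

theorem PsState.Valid.typed {S : PsState} (h : S.Valid) : S.cell.Typed S.ctx := by
  obtain ⟨x, hx, h⟩ := h.psAt
  simpa only [Cell.Typed, hx] using h.isTm

theorem PsState.Valid.ps {S : PsState} (h : S.Valid) : Ps S.ctx := by
  obtain ⟨x, hx, h⟩ := h.psAt
  exact h.ps

theorem PsState.Valid.notMem {S : PsState} (h : S.Valid) : S.ctx.length ∉ S.ctx.fv := by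
  simp [h.normal.fv_eq]

theorem PsState.valid_pss : PsState.pss.Valid :=
  ⟨⟨trivial, rfl⟩, 0, rfl, .pss 0⟩

theorem PsState.Valid.pse {S : PsState} (h : S.Valid) : S.pse.Valid := by
  refine ⟨⟨⟨h.normal, rfl⟩, rfl⟩, _, rfl, ?_⟩
  obtain ⟨x, hx, h'⟩ := h.psAt
  simp only [PsState.pse, hx]
  exact .pse _ _ h' h.notMem (by simp [Ctx.fv, h.normal.fv_eq])

theorem PsState.Valid.psd {S : PsState} (h : S.Valid) : S.psd.Valid := by
  refine ⟨h.normal, ?_⟩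
  obtain ⟨x, hx, h'⟩ := h.psAt
  obtain ⟨Γ, t, A⟩ := S
  cases A with
  | ob => exact ⟨x, hx, h'⟩
  | arr A s t =>
    obtain ⟨-, a, b, rfl, rfl⟩ := h'.allVar
    exact ⟨b, rfl, h'.psd⟩

theorem PsState.Valid.iterate_pse {S : PsState} (h : S.Valid) (m : ℕ) :
    (PsState.pse^[m] S).Valid := by
  induction m with
  | zero => exact h
  | succ m ih => rw [Function.iterate_succ_apply']; exact ih.pse

theorem PsState.Valid.iterate_psd {S : PsState} (h : S.Valid) (m : ℕ) :
    (PsState.psd^[m] S).Valid := by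
  induction m with
  | zero => exact h
  | succ m ih => rw [Function.iterate_succ_apply']; exact ih.psd

theorem PsState.iterate_psd (S : PsState) (m : ℕ) :
    PsState.psd^[m] S = ⟨S.ctx, Cell.tgt^[m] S.cell⟩ := by
  induction m with
  | zero => rfl
  | succ m ih => rw [Function.iterate_succ_apply', ih, Function.iterate_succ_apply']; rfl

theorem valid_globe (d : ℕ) : (globe d).Valid := PsState.valid_pss.iterate_pse d

theorem valid_glue (d n : ℕ) : (glue d n).Valid := ((valid_globe d).iterate_psd _).iterate_pse _

theorem PsState.dim_iterate_pse (S : PsState) (m : ℕ) :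
    (PsState.pse^[m] S).cell.ty.dim = S.cell.ty.dim + m := by
  induction m with
  | zero => rfl
  | succ m ih => rw [Function.iterate_succ_apply', ← add_assoc, ← ih]; rfl

theorem dim_globe (d : ℕ) : (globe d).cell.ty.dim = d :=
  (PsState.dim_iterate_pse _ d).trans (Nat.zero_add d)

theorem dim_glue {d n : ℕ} (h : n ≤ d) : (glue d n).cell.ty.dim = d := by
  rw [glue, PsState.dim_iterate_pse, PsState.iterate_psd, Cell.dim_iterate_tgt, dim_globe]; omega

theorem PsState.ctx_dim_iterate_pse {S : PsState} (h : S.cell.ty.dim ≤ S.ctx.dim) (m : ℕ) :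
    (PsState.pse^[m] S).ctx.dim = max S.ctx.dim (S.cell.ty.dim + m) := by
  induction m with
  | zero => simpa using h
  | succ m ih =>
    rw [Function.iterate_succ_apply']
    simp only [PsState.pse, Ctx.dim, Ty.dim, ih, PsState.dim_iterate_pse]
    omega

theorem ctx_dim_globe (d : ℕ) : (globe d).ctx.dim = d :=
  (PsState.ctx_dim_iterate_pse (le_refl _) d).trans (by simp [PsState.pss, Ctx.dim, Ty.dim])

theorem ctx_dim_glue {d n : ℕ} (h : n ≤ d) : (glue d n).ctx.dim = d := by
  rw [glue, PsState.ctx_dim_iterate_pse, PsState.iterate_psd] <;>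
    simp only [PsState.iterate_psd, ctx_dim_globe, Cell.dim_iterate_tgt, dim_globe] <;> omega

theorem PsState.mem_iterate_pse {S : PsState} {x : ℕ} {A : Ty} (m : ℕ) (h : S.ctx.Mem x A) :
    (PsState.pse^[m] S).ctx.Mem x A := by
  induction m with
  | zero => exact h
  | succ m ih => rw [Function.iterate_succ_apply']; exact .inr (.inr ih)

theorem iterate_src_iterate_pse (S : PsState) (m : ℕ) :
    Cell.src^[m] (PsState.pse^[m] S).cell = S.cell := by
  induction m with
  | zero => rfl
  | succ m ih => rw [Function.iterate_succ_apply, Function.iterate_succ_apply']; exact ih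

/-- The two top cells of the gluing `O^d_n` share an `n`-dimensional boundary. -/
theorem glue_boundary (d n : ℕ) :
    Cell.src^[d - n] (glue d n).cell = Cell.tgt^[d - n] (globe d).cell := by
  rw [glue, iterate_src_iterate_pse, PsState.iterate_psd]

/-! ### Variables of globes and gluings, and of their boundaries -/

theorem PsState.fv_pse_ctx (S : PsState) :
    S.pse.ctx.fv = S.ctx.fv ∪ {S.ctx.length} ∪ {S.ctx.length + 1} := rfl

theorem PsState.fv_pse_cell (S : PsState) :
    S.pse.cell.fv = S.cell.fv ∪ {S.ctx.length} ∪ {S.ctx.length + 1} := by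
  ext x; simp only [PsState.pse, Cell.fv, Ty.fv, Tm.fv, Finset.mem_union]; tauto

theorem PsState.srcAt_pse_of_lt {S : PsState} {k : ℕ} (h : S.cell.ty.dim < k) :
    (S.pse.ctx.srcAt k).fv = (S.ctx.srcAt k).fv ∪ {S.ctx.length} ∪ {S.ctx.length + 1} := by
  simp [PsState.pse, Ctx.srcAt, Ctx.fv, h.not_ge]

theorem PsState.srcAt_pse_of_le {S : PsState} {k : ℕ} (h : k ≤ S.cell.ty.dim) :
    S.pse.ctx.srcAt k = S.ctx.srcAt k := by
  simp [PsState.pse, Ctx.srcAt, h]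

theorem PsState.tgtAt_pse_of_lt {S : PsState} {k : ℕ} (h : S.cell.ty.dim < k) :
    S.pse.ctx.tgtAt k = ((S.ctx.tgtAt k).snoc S.ctx.length S.cell.ty).snoc (S.ctx.length + 1)
      S.pse.cell.ty := by
  simp [PsState.pse, Ctx.tgtAt, h.not_gt, h.ne']

theorem PsState.tgtAt_pse_of_eq {S : PsState} {k : ℕ} (h : k = S.cell.ty.dim) :
    S.pse.ctx.tgtAt k = (S.ctx.tgtAt k).drop.snoc S.ctx.length S.cell.ty := by
  simp [PsState.pse, Ctx.tgtAt, h]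

/-- Cells of dimension at most `k` added by (PSE) remain in the `k`-source. -/
theorem PsState.srcAt_iterate_pse {S : PsState} {k : ℕ} (h : S.cell.fv ⊆ (S.ctx.srcAt k).fv)
    (m : ℕ) (hk : S.cell.ty.dim + m ≤ k) :
    ((PsState.pse^[m] S).ctx.srcAt k).fv = (S.ctx.srcAt k).fv ∪ (PsState.pse^[m] S).cell.fv := by
  induction m with
  | zero => exact (Finset.union_eq_left.2 h).symm
  | succ m ih =>
    rw [Function.iterate_succ_apply', PsState.srcAt_pse_of_lt (by rw [dim_iterate_pse]; omega),
      ih (by omega), PsState.fv_pse_cell]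
    simp only [Finset.union_assoc]

/-- Cells of dimension at most `k` added by (PSE) remain in the `k`-target. -/
theorem PsState.tgtAt_iterate_pse {S : PsState} {k : ℕ} (h : S.cell.fv ⊆ (S.ctx.tgtAt k).fv)
    (m : ℕ) (hk : S.cell.ty.dim + m ≤ k) :
    ((PsState.pse^[m] S).ctx.tgtAt k).fv = (S.ctx.tgtAt k).fv ∪ (PsState.pse^[m] S).cell.fv := by
  induction m with
  | zero => exact (Finset.union_eq_left.2 h).symm
  | succ m ih =>
    rw [Function.iterate_succ_apply', PsState.tgtAt_pse_of_lt (by rw [dim_iterate_pse]; omega)]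
    simp only [Ctx.fv]
    rw [ih (by omega), PsState.fv_pse_cell]
    simp only [Finset.union_assoc]

theorem globe_succ (d : ℕ) : globe (d + 1) = (globe d).pse := Function.iterate_succ_apply' _ _ _

theorem fv_globe (d : ℕ) : (globe d).ctx.fv = (globe d).cell.fv := by
  induction d with
  | zero => rfl
  | succ d ih => rw [globe_succ, PsState.fv_pse_ctx, PsState.fv_pse_cell, ih]

theorem srcAt_globe {d k : ℕ} (h : d ≤ k) : ((globe d).ctx.srcAt k).fv = (globe d).cell.fv := by
  induction d with
  | zero => rfl
  | succ d ih =>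
    rw [globe_succ, PsState.srcAt_pse_of_lt (by rw [dim_globe]; omega), PsState.fv_pse_cell,
      ih (by omega)]

theorem tgtAt_globe {d k : ℕ} (h : d ≤ k) : (globe d).ctx.tgtAt k = (globe d).ctx := by
  induction d with
  | zero => rfl
  | succ d ih =>
    rw [globe_succ, PsState.tgtAt_pse_of_lt (by rw [dim_globe]; omega), ih (by omega)]
    rfl

theorem Ctx.drop_snoc (Γ : Ctx) (x : ℕ) (A : Ty) : (Γ.snoc x A).drop = Γ := rfl

/-- Without its top cell, a globe consists of the boundary of this cell. -/
theorem drop_globe (d : ℕ) : (globe d).ctx.drop.fv = (globe d).cell.ty.fv := by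
  cases d with
  | zero => rfl
  | succ d =>
    rw [globe_succ]
    simp only [PsState.pse, Ctx.drop, Ctx.fv, Ty.fv, Tm.fv, fv_globe, Cell.fv]
    ext x; simp only [Finset.mem_union]; tauto

theorem srcAt_globe_succ (d : ℕ) :
    ((globe (d + 1)).ctx.srcAt d).fv = (globe (d + 1)).cell.src.fv := by
  rw [globe_succ, PsState.srcAt_pse_of_le (dim_globe d).ge, srcAt_globe le_rfl]
  rfl

theorem tgtAt_globe_succ (d : ℕ) :
    (globe (d + 1)).ctx.tgtAt d =
      (globe d).ctx.drop.snoc (globe d).ctx.length (globe d).cell.ty := by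
  rw [globe_succ, PsState.tgtAt_pse_of_eq (dim_globe d).symm, tgtAt_globe le_rfl]

theorem fv_tgtAt_globe_succ (d : ℕ) :
    ((globe (d + 1)).ctx.tgtAt d).fv = (globe (d + 1)).cell.tgt.fv := by
  rw [tgtAt_globe_succ, Ctx.fv, drop_globe, globe_succ, Finset.union_comm]
  rfl

theorem glue_succ (n : ℕ) {d m : ℕ} (h : d = n + m) :
    glue (d + 1) n = (PsState.pse^[m] ⟨(globe (d + 1)).ctx,
      Cell.tgt^[m + 1] (globe (d + 1)).cell⟩).pse := by
  rw [glue, show d + 1 - n = m + 1 by omega, Function.iterate_succ_apply', PsState.iterate_psd]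

/-- The source of the gluing of two globes along their codimension one boundary is the source of the
first globe. -/
theorem fv_src_glue_zero (n : ℕ) :
    (glue (n + 1) n).ctx.src.fv = (globe (n + 1)).cell.src.fv := by
  rw [Ctx.src, ctx_dim_glue (by omega), Nat.add_sub_cancel, glue_succ n (m := 0) rfl,
    PsState.srcAt_pse_of_le, ← srcAt_globe_succ]
  · rfl
  · simp [Cell.dim_tgt, dim_globe]

/-- The target of the gluing of two globes along their codimension one boundary is the target of the
second globe. -/
theorem fv_tgt_glue_zero (n : ℕ) :
    (glue (n + 1) n).ctx.tgt.fv = (glue (n + 1) n).cell.tgt.fv := by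
  rw [Ctx.tgt, ctx_dim_glue (by omega), Nat.add_sub_cancel, glue_succ n (m := 0) rfl,
    PsState.tgtAt_pse_of_eq]
  · simp only [Function.iterate_zero, id_eq, tgtAt_globe_succ]
    rw [Ctx.drop_snoc, Ctx.fv, drop_globe, Finset.union_comm, globe_succ]
    rfl
  · simp [Cell.dim_tgt, dim_globe]

theorem Cell.iterate_tgt_src {u : Cell} {m : ℕ} (h : m + 2 ≤ u.ty.dim) :
    Cell.tgt^[m + 1] u.src = Cell.tgt^[m + 1] u.tgt := by
  rw [Function.iterate_succ_apply, Function.iterate_succ_apply, Cell.tgt_src_eq (by omega)]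

/-- The source of the gluing of two globes along a boundary of codimension at least two consists of
the sources of both globes. -/
theorem fv_src_glue_succ {d n m : ℕ} (h : d = n + (m + 1)) :
    (glue (d + 1) n).ctx.src.fv = (globe (d + 1)).cell.src.fv ∪ (glue (d + 1) n).cell.src.fv := by
  rw [Ctx.src, ctx_dim_glue (by omega), Nat.add_sub_cancel, glue_succ n h,
    PsState.srcAt_pse_of_le, PsState.srcAt_iterate_pse, srcAt_globe_succ]
  · rfl
  · -- In codimension at least two, the common boundary also lies in the source of the first globe.
    rw [Function.iterate_succ_apply, srcAt_globe_succ,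
      ← Cell.iterate_tgt_src (by rw [dim_globe]; omega)]
    exact Cell.fv_iterate_tgt_subset _ _
  · rw [Cell.dim_iterate_tgt, dim_globe]; omega
  · rw [PsState.dim_iterate_pse, Cell.dim_iterate_tgt, dim_globe]; omega

/-- The target of the gluing of two globes along a boundary of codimension at least two consists of
the targets of both globes. -/
theorem fv_tgt_glue_succ {d n m : ℕ} (h : d = n + (m + 1)) :
    (glue (d + 1) n).ctx.tgt.fv = (globe (d + 1)).cell.tgt.fv ∪ (glue (d + 1) n).cell.tgt.fv := by
  rw [Ctx.tgt, ctx_dim_glue (by omega), Nat.add_sub_cancel, glue_succ n h,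
    PsState.tgtAt_pse_of_eq, Function.iterate_succ_apply', PsState.tgtAt_pse_of_lt]
  · simp only [Ctx.drop, Ctx.fv]
    rw [PsState.tgtAt_iterate_pse, fv_tgtAt_globe_succ]
    · simp only [PsState.pse, Cell.tgt, Cell.fv, Ty.fv, Tm.fv]
      ext x; simp only [Finset.mem_union]; tauto
    · rw [Function.iterate_succ_apply, fv_tgtAt_globe_succ]
      exact Cell.fv_iterate_tgt_subset _ _
    · rw [Cell.dim_iterate_tgt, dim_globe]; omega
  · rw [PsState.dim_iterate_pse, Cell.dim_iterate_tgt, dim_globe]; omega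
  · rw [PsState.dim_iterate_pse, Cell.dim_iterate_tgt, dim_globe]; omega

/-! ### Substitutions into globes and gluings -/

theorem IsSubst.length_eq {Δ : Ctx} : ∀ {γ : Subst} {Γ : Ctx}, IsSubst Δ γ Γ →
    γ.length = Γ.length
  | _, _, .es _ => rfl
  | _, _, .se hγ _ _ => congrArg (· + 1) hγ.length_eq

theorem Subst.length_comp (δ : Subst) : ∀ γ : Subst, (γ.comp δ).length = γ.length
  | .nil => rfl
  | .snoc γ _ _ => congrArg (· + 1) (Subst.length_comp δ γ)

theorem Subst.comp_push (γ δ : Subst) (t : Tm) :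
    (γ.push t).comp δ = (γ.comp δ).push (t.subst δ) := by
  simp only [Subst.push, Subst.comp, Subst.length_comp]

theorem Subst.comp_pushCell (γ δ : Subst) (m : ℕ) (v : Cell) :
    (γ.pushCell m v).comp δ = (γ.comp δ).pushCell m (v.subst δ) := by
  induction m generalizing v with
  | zero => rfl
  | succ m ih =>
    simp only [Subst.pushCell, Subst.comp_push, ih, Cell.subst_src, Cell.subst_tgt]
    rfl

theorem globeSubst_comp (d : ℕ) (u : Cell) (δ : Subst) :
    (globeSubst d u).comp δ = globeSubst d (u.subst δ) := by
  rw [globeSubst, Subst.comp_pushCell, Subst.comp_push, globeSubst, Cell.iterate_src_subst]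
  rfl

theorem glueSubst_comp (d n : ℕ) (u v : Cell) (δ : Subst) :
    (glueSubst d n u v).comp δ = glueSubst d n (u.subst δ) (v.subst δ) := by
  rw [glueSubst, Subst.comp_pushCell, globeSubst_comp, glueSubst]

theorem Cell.subst_congr {γ δ : Subst} {u : Cell} (h : ∀ x ∈ u.fv, γ.get x = δ.get x) :
    u.subst γ = u.subst δ := by
  simp only [Cell.subst]
  rw [Tm.subst_congr _ fun x hx => h x (Finset.mem_union_left _ hx),
    Ty.subst_congr _ fun x hx => h x (Finset.mem_union_right _ hx)]

/-- A substitution into a pasting context which sends its distinguished cell to `σ^m(v)` extends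
along `m` applications of (PSE) to one which sends the new distinguished cell to `v`. -/
theorem isSubst_pushCell {K : Ctx} {γ : Subst} {S : PsState} (hS : S.Valid)
    (hγ : IsSubst K γ S.ctx) (m : ℕ) {v : Cell} (hv : v.Typed K)
    (hdim : v.ty.dim = S.cell.ty.dim + m) (hsrc : S.cell.subst γ = Cell.src^[m] v) :
    IsSubst K (γ.pushCell m v) (PsState.pse^[m] S).ctx ∧
      (PsState.pse^[m] S).cell.subst (γ.pushCell m v) = v ∧
      ∀ x ∈ S.ctx.fv, (γ.pushCell m v).get x = γ.get x := by
  induction m generalizing v with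
  | zero => exact ⟨hγ, hsrc, fun _ _ => rfl⟩
  | succ m ih =>
    obtain ⟨h₁, h₂, h₃⟩ := ih hv.src (by rw [Cell.dim_src]; omega) hsrc
    rw [Function.iterate_succ_apply']
    have hS' := hS.iterate_pse m
    have hsub : S.ctx.fv ⊆ (PsState.pse^[m] S).ctx.fv := by
      clear * -
      induction m with
      | zero => rfl
      | succ m ih =>
        rw [Function.iterate_succ_apply', PsState.fv_pse_ctx]
        exact ih.trans (Finset.subset_union_left.trans Finset.subset_union_left)
    generalize PsState.pse^[m] S = S' at *
    have hlen := h₁.length_eq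
    rw [Subst.pushCell]
    generalize γ.pushCell m v.src = γ' at *
    obtain ⟨t, _ | ⟨A, a, b⟩⟩ := v
    · simp [Ty.dim] at hdim
    simp only [Cell.src, Cell.tgt] at h₂ ⊢
    obtain ⟨hnew, hctx⟩ : S'.ctx.length ∉ S'.ctx.fv ∧ IsCtx S'.pse.ctx :=
      ⟨hS'.notMem, IsTm.isCtx hS'.pse.typed⟩
    have hnew' : S'.ctx.length + 1 ∉ (S'.ctx.snoc S'.ctx.length S'.cell.ty).fv := by
      simp [Ctx.fv, hS'.normal.fv_eq]
    have hfv := hS'.typed.fv_subset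
    have hpush : ∀ (s : Tm), γ'.push s = γ'.snoc S'.ctx.length s := fun s => by
      rw [Subst.push, hlen]
    have hpush' : (γ'.push b).push t = (γ'.snoc S'.ctx.length b).snoc (S'.ctx.length + 1) t := by
      rw [hpush, Subst.push, Subst.length, hlen]
    have hget : ∀ x ∈ S'.ctx.fv, ((γ'.push b).push t).get x = γ'.get x := fun x hx => by
      rw [hpush', Subst.get_snoc_of_ne, Subst.get_snoc_of_ne]
      · rintro rfl; exact hnew hx
      · rintro rfl; exact hnew' (Finset.mem_union_left _ hx)
    have hcell : S'.cell.subst ((γ'.push b).push t) = ⟨a, A⟩ := by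
      rw [Cell.subst_congr fun x hx => hget x (hfv hx), h₂]
    have hB : S'.pse.cell.ty.subst ((γ'.push b).push t) = .arr A a b := by
      simp only [PsState.pse, Ty.subst]
      have h := hcell
      simp only [Cell.subst, Cell.mk.injEq] at h
      rw [h.1, h.2, hpush']
      simp [Tm.subst, Subst.get]
    have h₂' : S'.cell.ty.subst γ' = A := congrArg Cell.ty h₂
    refine ⟨?_, ?_, fun x hx => (hget x (hsub hx)).trans (h₃ x hx)⟩
    · have hctx' : IsCtx (S'.ctx.snoc S'.ctx.length S'.cell.ty) := by
        cases hctx with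
        | ce h _ => exact h.isCtx
      rw [hpush']
      refine .se (.se h₁ hctx' (by rw [h₂']; exact hv.tgt)) hctx ?_
      rw [hpush', Ty.subst_snoc] at hB
      · exact hB ▸ hv
      · cases hctx with
        | ce h _ => exact fun hx => hnew' (h.fv_subset.1 hx)
    · rw [Cell.subst, hB, hpush']
      simp [PsState.pse, Tm.subst, Subst.get]

theorem isSubst_globeSubst {K : Ctx} {u : Cell} (hu : u.Typed K) :
    IsSubst K (globeSubst u.ty.dim u) (globe u.ty.dim).ctx ∧
      (globe u.ty.dim).cell.subst (globeSubst u.ty.dim u) = u := by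
  have h₀ := hu.iterate_src u.ty.dim
  have hd := u.dim_iterate_src u.ty.dim
  have hs : PsState.pss.cell.subst (Subst.nil.push (Cell.src^[u.ty.dim] u).tm) =
      Cell.src^[u.ty.dim] u := by
    generalize Cell.src^[u.ty.dim] u = w at *
    obtain ⟨t, _ | _⟩ := w
    · rfl
    · simp [Ty.dim] at hd
  have := isSubst_pushCell PsState.valid_pss (K := K)
    (γ := Subst.nil.push (Cell.src^[u.ty.dim] u).tm) (.se (.es h₀.isCtx)
      (.ce (.ob .ec) (by simp [Ctx.fv])) (by rw [← hs] at h₀; exact h₀)) u.ty.dim hu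
      (Nat.zero_add _).symm hs
  exact ⟨this.1, this.2.1⟩

theorem isSubst_glueSubst {K : Ctx} {u v : Cell} {d n : ℕ} (hn : n ≤ d) (hu : u.Typed K)
    (hv : v.Typed K) (hud : u.ty.dim = d) (hvd : v.ty.dim = d)
    (huv : Cell.tgt^[d - n] u = Cell.src^[d - n] v) :
    IsSubst K (glueSubst d n u v) (glue d n).ctx ∧
      (globe d).cell.subst (glueSubst d n u v) = u ∧
      (glue d n).cell.subst (glueSubst d n u v) = v := by
  subst hud
  obtain ⟨h₁, h₂⟩ := isSubst_globeSubst hu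
  obtain ⟨h₃, h₄, h₅⟩ := isSubst_pushCell ((valid_globe u.ty.dim).iterate_psd (u.ty.dim - n))
    (γ := globeSubst u.ty.dim u) (K := K) (by rwa [PsState.iterate_psd]) (u.ty.dim - n) hv
    (by rw [PsState.iterate_psd, Cell.dim_iterate_tgt, dim_globe]; omega)
    (by rw [PsState.iterate_psd, ← Cell.iterate_tgt_subst, h₂, huv])
  refine ⟨h₃, ?_, h₄⟩
  refine (Cell.subst_congr fun x hx => h₅ x ?_).trans h₂
  rw [PsState.iterate_psd]
  exact (valid_globe _).typed.fv_subset hx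

theorem Subst.fv_pushCell {γ : Subst} {m : ℕ} {v : Cell} (hm : m ≤ v.ty.dim)
    (h : (Cell.src^[m] v).fv ⊆ γ.fv) : (γ.pushCell m v).fv = γ.fv ∪ v.fv := by
  induction m generalizing v with
  | zero => exact (Finset.union_eq_left.2 h).symm
  | succ m ih =>
    rw [Subst.pushCell, Cell.fv_eq (by omega)]
    simp only [Subst.push, Subst.fv]
    rw [ih (by rw [Cell.dim_src]; omega) h]
    simp only [Finset.union_assoc]

theorem fv_globeSubst (u : Cell) : (globeSubst u.ty.dim u).fv = u.fv := by
  have hfv : (Subst.nil.push (Cell.src^[u.ty.dim] u).tm).fv = (Cell.src^[u.ty.dim] u).fv := by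
    have hd := u.dim_iterate_src u.ty.dim
    generalize Cell.src^[u.ty.dim] u = w at *
    obtain ⟨t, _ | _⟩ := w
    · simp [Subst.push, Subst.fv, Cell.fv, Ty.fv]
    · simp [Ty.dim] at hd
  rw [globeSubst, Subst.fv_pushCell le_rfl hfv.ge, hfv, Finset.union_eq_right]
  exact Cell.fv_iterate_src_subset _ _

theorem fv_glueSubst {u v : Cell} {d n : ℕ} (hud : u.ty.dim = d) (hvd : v.ty.dim = d)
    (huv : Cell.tgt^[d - n] u = Cell.src^[d - n] v) :
    (glueSubst d n u v).fv = u.fv ∪ v.fv := by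
  subst hud
  rw [glueSubst, Subst.fv_pushCell (by omega), fv_globeSubst]
  rw [← huv, fv_globeSubst]
  exact Cell.fv_iterate_tgt_subset _ _


/-! ### Identities -/

/-- Iterated identities are well typed, raise the dimension by the number of iterations, have the
variables of the given cell and are stable under substitution. Typing the next identity
uses the variables of the previous one on the top cell of a globe, hence the joint induction. -/
theorem Cell.ident_spec (k : ℕ) : ∀ {K : Ctx} {u : Cell}, u.Typed K →
    (u.ident k).Typed K ∧ (u.ident k).ty.dim = u.ty.dim + k ∧ (u.ident k).fv = u.fv ∧
      ∀ {L : Ctx} {δ : Subst}, IsSubst L δ K → (u.ident k).subst δ = (u.subst δ).ident k := by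
  induction k with
  | zero => exact fun h => ⟨h, rfl, rfl, fun _ => rfl⟩
  | succ k ih =>
    intro K u hu
    obtain ⟨h₁, h₂, h₃, h₄⟩ := ih (valid_globe u.ty.dim).typed
    obtain ⟨hγ, hc⟩ := isSubst_globeSubst hu
    rw [← fv_globe, Cell.fv] at h₃
    rw [dim_globe] at h₂
    have hB := IsTy.arr h₁ h₁
    have hfv := Ty.fv_subst_subset (γ := globeSubst u.ty.dim u) _ (hγ.dom_eq ▸ hB.fv_subset.1)
    refine ⟨.coh (valid_globe _).ps (valid_globe _).normal hB hγ h₃.symm h₃.symm, ?_, ?_, ?_⟩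
    · simp only [Cell.ident, Ty.dim_subst, Ty.dim, h₂]; rfl
    · simp only [Cell.ident]
      rw [Cell.fv, Tm.fv, Finset.union_eq_left.2 hfv, fv_globeSubst]
    · intro L δ hδ
      simp only [Cell.ident]
      rw [Cell.subst, Tm.subst, Ty.subst_subst _ (hγ.dom_eq ▸ hB.fv_subset.1), globeSubst_comp,
        show (u.subst δ).ty.dim = u.ty.dim from Ty.dim_subst _ _]

theorem Cell.Typed.ident {K : Ctx} {u : Cell} (h : u.Typed K) (k : ℕ) : (u.ident k).Typed K :=
  (Cell.ident_spec k h).1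

theorem Cell.dim_ident {K : Ctx} {u : Cell} (h : u.Typed K) (k : ℕ) :
    (u.ident k).ty.dim = u.ty.dim + k := (Cell.ident_spec k h).2.1

theorem Cell.fv_ident {K : Ctx} {u : Cell} (h : u.Typed K) (k : ℕ) : (u.ident k).fv = u.fv :=
  (Cell.ident_spec k h).2.2.1

/-- The term `w` of the identity type `w → w` in `Cell.ident` becomes the previous identity on `u`. -/
theorem Cell.ident_boundary {K : Ctx} {u : Cell} (h : u.Typed K) (k : ℕ) :
    ((Cell.ident k (globe u.ty.dim).cell)).subst (globeSubst u.ty.dim u) = u.ident k := by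
  obtain ⟨hγ, hc⟩ := isSubst_globeSubst h
  rw [(Cell.ident_spec k (valid_globe u.ty.dim).typed).2.2.2 hγ, hc]

theorem Cell.src_ident {K : Ctx} {u : Cell} (h : u.Typed K) (k : ℕ) :
    (u.ident (k + 1)).src = u.ident k := Cell.ident_boundary h k

theorem Cell.tgt_ident {K : Ctx} {u : Cell} (h : u.Typed K) (k : ℕ) :
    (u.ident (k + 1)).tgt = u.ident k := Cell.ident_boundary h k

theorem Cell.iterate_tgt_ident {K : Ctx} {u : Cell} (h : u.Typed K) (k : ℕ) :
    Cell.tgt^[k] (u.ident k) = u := by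
  induction k with
  | zero => rfl
  | succ k ih => rw [Function.iterate_succ_apply, Cell.tgt_ident h, ih]

/-! ### Binary compositions -/

/-- The cells `u` and `v` of dimension `d` can be composed along a cell of dimension `n < d`. -/
structure Composable (K : Ctx) (d n : ℕ) (u v : Cell) : Prop where
  lt : n < d
  left : u.Typed K
  right : v.Typed K
  dim_left : u.ty.dim = d
  dim_right : v.ty.dim = d
  match_eq : Cell.tgt^[d - n] u = Cell.src^[d - n] v

theorem Composable.src {K : Ctx} {d n : ℕ} {u v : Cell} (h : Composable K (d + 1) n u v)
    (hn : n < d) : Composable K d n u.src v.src where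
  lt := hn
  left := h.left.src
  right := h.right.src
  dim_left := by rw [Cell.dim_src, h.dim_left]; rfl
  dim_right := by rw [Cell.dim_src, h.dim_right]; rfl
  match_eq := by
    obtain ⟨m, rfl⟩ : ∃ m, d = n + (m + 1) := ⟨d - n - 1, by omega⟩
    have := h.match_eq
    rw [show n + (m + 1) + 1 - n = m + 1 + 1 by omega, Function.iterate_succ_apply,
      ← Cell.iterate_tgt_src (by rw [h.dim_left]; omega)] at this
    rw [show n + (m + 1) - n = m + 1 by omega, this]
    rfl

theorem Composable.tgt {K : Ctx} {d n : ℕ} {u v : Cell} (h : Composable K (d + 1) n u v)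
    (hn : n < d) : Composable K d n u.tgt v.tgt where
  lt := hn
  left := h.left.tgt
  right := h.right.tgt
  dim_left := by rw [Cell.dim_tgt, h.dim_left]; rfl
  dim_right := by rw [Cell.dim_tgt, h.dim_right]; rfl
  match_eq := by
    obtain ⟨m, rfl⟩ : ∃ m, d = n + (m + 1) := ⟨d - n - 1, by omega⟩
    have := h.match_eq
    rw [show n + (m + 1) + 1 - n = m + 1 + 1 by omega, Function.iterate_succ_apply] at this
    rw [show n + (m + 1) - n = m + 1 by omega, this, Function.iterate_succ_apply,
      Function.iterate_succ_apply, Function.iterate_succ_apply, Cell.src_tgt_eq]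
    rw [h.dim_right]; omega

theorem typed_globe_glue (d n : ℕ) : (globe d).cell.Typed (glue d n).ctx := by
  refine IsTm.weaken (IsTm.isCtx (valid_glue d n).typed) (valid_globe d).typed fun x A h => ?_
  refine PsState.mem_iterate_pse _ ?_
  rwa [PsState.iterate_psd]

/-- The two top cells of a gluing are composable. -/
theorem composable_glue {d n : ℕ} (h : n < d) :
    Composable (glue d n).ctx d n (globe d).cell (glue d n).cell where
  lt := h
  left := typed_globe_glue d n
  right := (valid_glue d n).typed
  dim_left := dim_globe d
  dim_right := dim_glue h.le
  match_eq := (glue_boundary d n).symm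

/-- The side conditions of the rule (OP) on the pasting context and the type of an operation. -/
def IsOpTy (Γ : Ctx) (B : Ty) : Prop :=
  ∃ A s t, B = .arr A s t ∧ IsTy Γ B ∧ Γ.src.fv = s.fv ∪ A.fv ∧ Γ.tgt.fv = t.fv ∪ A.fv

section
variable {K : Ctx} {d n : ℕ} {u v : Cell}

theorem Composable.isSubst (h : Composable K d n u v) :
    IsSubst K (glueSubst d n u v) (glue d n).ctx :=
  (isSubst_glueSubst h.lt.le h.left h.right h.dim_left h.dim_right h.match_eq).1

theorem Composable.typed_of_isOpTy (h : Composable K d n u v)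
    (hop : IsOpTy (glue d n).ctx (compTy n (d - n - 1))) : (Cell.comp d n u v).Typed K := by
  obtain ⟨A, s, t, hB, hty, hs, ht⟩ := hop
  rw [Cell.comp, hB]
  refine .op (valid_glue d n).ps (valid_glue d n).normal ?_ (hB ▸ hty) h.isSubst hs ht
  rw [ctx_dim_glue h.lt.le]
  exact h.lt.pos

theorem Composable.fv_comp_tm (h : Composable K d n u v) :
    (Cell.comp d n u v).tm.fv = u.fv ∪ v.fv :=
  fv_glueSubst h.dim_left h.dim_right h.match_eq

theorem Composable.ty_fv_subset (_ : Composable K d n u v) (ht : (Cell.comp d n u v).Typed K) :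
    (Cell.comp d n u v).ty.fv ⊆ (Cell.comp d n u v).tm.fv :=
  IsTm.ty_fv_subset_op ht

theorem Composable.subst_of_isOpTy (h : Composable K d n u v)
    (hop : IsOpTy (glue d n).ctx (compTy n (d - n - 1))) (δ : Subst) :
    (Cell.comp d n u v).subst δ = Cell.comp d n (u.subst δ) (v.subst δ) := by
  obtain ⟨A, s, t, hB, hty, hs, ht⟩ := hop
  rw [Cell.comp, Cell.subst, Cell.comp, Tm.subst,
    Ty.subst_subst _ (h.isSubst.dom_eq ▸ hty.fv_subset.1), glueSubst_comp]

end

/-- The type of the composite in terms of `Cell.comp`, one dimension below. -/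
theorem compTy_succ (n m : ℕ) : compTy n (m + 1) =
    .arr
      (Cell.comp (n + 1 + m) n (globe (n + 1 + m + 1)).cell.src
        (glue (n + 1 + m + 1) n).cell.src).ty
      (Cell.comp (n + 1 + m) n (globe (n + 1 + m + 1)).cell.src
        (glue (n + 1 + m + 1) n).cell.src).tm
      (Cell.comp (n + 1 + m) n (globe (n + 1 + m + 1)).cell.tgt
        (glue (n + 1 + m + 1) n).cell.tgt).tm := by
  simp only [Cell.comp, show n + 1 + m - n - 1 = m by omega]
  rfl

theorem dim_compTy (n m : ℕ) : (compTy n m).dim = n + 1 + m := by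
  induction m with
  | zero => rw [compTy, Ty.dim, Cell.dim_src, dim_globe]; rfl
  | succ m ih =>
    rw [compTy, Ty.dim, Ty.dim_subst, ih]; rfl

theorem Cell.dim_comp {d n : ℕ} (h : n < d) (u v : Cell) : (Cell.comp d n u v).ty.dim = d := by
  rw [Cell.comp, Ty.dim_subst, dim_compTy]; omega

section
variable {K : Ctx} {n : ℕ} {u v : Cell}

/-- The composite along codimension one goes from `σ(u)` to `τ(v)`. -/
theorem Composable.ty_comp_top (h : Composable K (n + 1) n u v) :
    (Cell.comp (n + 1) n u v).ty = .arr u.src.ty u.src.tm v.tgt.tm := by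
  obtain ⟨-, hu, hv⟩ :=
    isSubst_glueSubst h.lt.le h.left h.right h.dim_left h.dim_right h.match_eq
  have hu' := Cell.subst_src (glueSubst (n + 1) n u v) (globe (n + 1)).cell
  have hv' := Cell.subst_tgt (glueSubst (n + 1) n u v) (glue (n + 1) n).cell
  rw [hu] at hu'
  rw [hv] at hv'
  rw [hu', hv', Cell.comp, show n + 1 - n - 1 = 0 by omega]
  rfl

/-- The composite along codimension at least two goes from `σ(u) ∗ σ(v)` to `τ(u) ∗ τ(v)`. -/
theorem Composable.ty_comp_of_isOpTy {m : ℕ} (h : Composable K (n + 1 + m + 1) n u v)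
    (hop : IsOpTy (glue (n + 1 + m) n).ctx (compTy n m)) :
    (Cell.comp (n + 1 + m + 1) n u v).ty =
      .arr (Cell.comp (n + 1 + m) n u.src v.src).ty (Cell.comp (n + 1 + m) n u.src v.src).tm
        (Cell.comp (n + 1 + m) n u.tgt v.tgt).tm := by
  obtain ⟨-, hu, hv⟩ :=
    isSubst_glueSubst h.lt.le h.left h.right h.dim_left h.dim_right h.match_eq
  have hg := composable_glue (d := n + 1 + m + 1) (n := n) (by omega)
  have hop' : IsOpTy (glue (n + 1 + m) n).ctx (compTy n (n + 1 + m - n - 1)) := by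
    rwa [show n + 1 + m - n - 1 = m by omega]
  have hs := (hg.src (by omega)).subst_of_isOpTy hop' (glueSubst (n + 1 + m + 1) n u v)
  have ht := (hg.tgt (by omega)).subst_of_isOpTy hop' (glueSubst (n + 1 + m + 1) n u v)
  rw [← Cell.subst_src, ← Cell.subst_src, hu, hv] at hs
  rw [← Cell.subst_tgt, ← Cell.subst_tgt, hu, hv] at ht
  rw [← hs, ← ht]
  conv_lhs => rw [Cell.comp, show n + 1 + m + 1 - n - 1 = m + 1 by omega, compTy_succ]
  rfl

/-- The composites of the sources and of the targets of two cells are parallel. -/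
theorem Composable.ty_comp_parallel {m : ℕ} (h : Composable K (n + 1 + m + 1) n u v)
    (hop : ∀ k < m, IsOpTy (glue (n + 1 + k) n).ctx (compTy n k)) :
    (Cell.comp (n + 1 + m) n u.tgt v.tgt).ty = (Cell.comp (n + 1 + m) n u.src v.src).ty := by
  have hs := h.src (by omega)
  have ht := h.tgt (by omega)
  have hu : 2 ≤ u.ty.dim := by rw [h.dim_left]; omega
  have hv : 2 ≤ v.ty.dim := by rw [h.dim_right]; omega
  cases m with
  | zero =>
    exact (ht.ty_comp_top).trans (by
      rw [Cell.src_tgt_eq hu, ← Cell.tgt_src_eq hv]; exact hs.ty_comp_top.symm)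
  | succ k =>
    have h₁ := ht.ty_comp_of_isOpTy (hop k (by omega))
    have h₂ := hs.ty_comp_of_isOpTy (hop k (by omega))
    rw [Cell.src_tgt_eq hu, Cell.src_tgt_eq hv, ← Cell.tgt_src_eq hu, ← Cell.tgt_src_eq hv] at h₁
    exact h₁.trans h₂.symm

end

/-- The type of the standard binary composite satisfies the side conditions of the rule (OP). -/
theorem isOpTy_compTy (n m : ℕ) : IsOpTy (glue (n + 1 + m) n).ctx (compTy n m) := by
  -- The well-formedness in dimension `m` uses `ty_comp_parallel`, hence all smaller dimensions.
  induction m using Nat.strong_induction_on with | _ m ih =>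
  cases m with
  | zero =>
    have hg := composable_glue (Nat.lt_succ_self n)
    have hty : (glue (n + 1) n).cell.tgt.ty = (globe (n + 1)).cell.src.ty := by
      have h := hg.match_eq
      rw [Nat.succ_eq_add_one, Nat.add_sub_cancel_left] at h
      have h₁ : (glue (n + 1) n).cell.tgt.ty = (glue (n + 1) n).cell.src.ty := by
        rcases (glue (n + 1) n).cell with ⟨_, _ | _⟩ <;> rfl
      have h₂ : (globe (n + 1)).cell.tgt.ty = (globe (n + 1)).cell.src.ty := by
        rcases (globe (n + 1)).cell with ⟨_, _ | _⟩ <;> rfl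
      rw [h₁, ← h₂]
      exact congrArg Cell.ty h.symm
    refine ⟨_, _, _, rfl, .arr hg.left.src (hty ▸ hg.right.tgt), ?_, ?_⟩
    · exact fv_src_glue_zero n
    · refine (fv_tgt_glue_zero n).trans ?_
      rw [← hty]
      rfl
  | succ m =>
    have hg := composable_glue (d := n + 1 + m + 1) (n := n) (by omega)
    have hop' : IsOpTy (glue (n + 1 + m) n).ctx (compTy n (n + 1 + m - n - 1)) := by
      rw [show n + 1 + m - n - 1 = m by omega]
      exact ih m (by omega)
    have hs := hg.src (by omega)
    have ht := hg.tgt (by omega)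
    have hs' := hs.typed_of_isOpTy hop'
    have ht' := ht.typed_of_isOpTy hop'
    have hsf := hs.fv_comp_tm
    have htf := ht.fv_comp_tm
    have hpar := hg.ty_comp_parallel fun k hk => ih k (by omega)
    rw [compTy_succ]
    refine ⟨_, _, _, rfl, .arr hs' (hpar ▸ ht'), ?_, ?_⟩
    · rw [Finset.union_eq_left.2 (hs.ty_fv_subset hs')]
      exact (fv_src_glue_succ (d := n + 1 + m) (m := m) (by omega)).trans hsf.symm
    · rw [← hpar, Finset.union_eq_left.2 (ht.ty_fv_subset ht')]
      exact (fv_tgt_glue_succ (d := n + 1 + m) (m := m) (by omega)).trans htf.symm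

section
variable {K : Ctx} {d n : ℕ} {u v : Cell}

theorem isOpTy_of_lt (h : n < d) : IsOpTy (glue d n).ctx (compTy n (d - n - 1)) := by
  have := isOpTy_compTy n (d - n - 1)
  rwa [show n + 1 + (d - n - 1) = d by omega] at this

theorem Composable.typed (h : Composable K d n u v) : (Cell.comp d n u v).Typed K :=
  h.typed_of_isOpTy (isOpTy_of_lt h.lt)

theorem Composable.fv_comp (h : Composable K d n u v) :
    (Cell.comp d n u v).fv = u.fv ∪ v.fv := by
  rw [← h.fv_comp_tm, Cell.fv, Finset.union_eq_left]
  exact IsTm.ty_fv_subset_op h.typed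

theorem Composable.src_comp (h : Composable K (d + 1) n u v) (hn : n < d) :
    (Cell.comp (d + 1) n u v).src = Cell.comp d n u.src v.src := by
  obtain ⟨m, rfl⟩ : ∃ m, d = n + 1 + m := ⟨d - n - 1, by omega⟩
  have := h.ty_comp_of_isOpTy (isOpTy_compTy n m)
  generalize Cell.comp (n + 1 + m + 1) n u v = w at *
  obtain ⟨t, A⟩ := w
  subst this
  rfl

theorem Composable.tgt_comp (h : Composable K (d + 1) n u v) (hn : n < d) :
    (Cell.comp (d + 1) n u v).tgt = Cell.comp d n u.tgt v.tgt := by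
  obtain ⟨m, rfl⟩ : ∃ m, d = n + 1 + m := ⟨d - n - 1, by omega⟩
  have := h.ty_comp_of_isOpTy (isOpTy_compTy n m)
  rw [← h.ty_comp_parallel fun k _ => isOpTy_compTy n k] at this
  generalize Cell.comp (n + 1 + m + 1) n u v = w at *
  obtain ⟨t, A⟩ := w
  subst this
  rfl

end

/-! ### Linear variables of identities and compositions -/

theorem Subst.LinearNone.pushCell {K : Ctx} {y : ℕ} {γ : Subst} (h : γ.LinearNone K y) (m : ℕ)
    {v : Cell} (hv : v.Typed K) (hm : m ≤ v.ty.dim) (hd : v.ty.dim ≤ K.varDim y)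
    (hlin : ¬ v.tm.Linear K y) : (γ.pushCell m v).LinearNone K y := by
  induction m generalizing v with
  | zero => exact h
  | succ m ih =>
    have hs : ¬ v.src.tm.Linear K y := fun hl => by
      have := hl.varDim_eq hv.src; rw [Cell.dim_src] at this; omega
    have ht : ¬ v.tgt.tm.Linear K y := fun hl => by
      have := hl.varDim_eq hv.tgt; rw [Cell.dim_tgt] at this; omega
    exact ⟨⟨ih hv.src (by rw [Cell.dim_src]; omega) (by rw [Cell.dim_src]; omega) hs, ht⟩, hlin⟩

theorem linearNone_globeSubst {K : Ctx} {y : ℕ} {u : Cell} (hu : u.Typed K)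
    (hd : u.ty.dim ≤ K.varDim y) (hlin : ¬ u.tm.Linear K y) :
    (globeSubst u.ty.dim u).LinearNone K y := by
  refine Subst.LinearNone.pushCell (γ := Subst.nil.push _) ⟨trivial, fun hl => ?_⟩ _ hu le_rfl hd
    hlin
  by_cases h0 : u.ty.dim = 0
  · rw [h0] at hl; exact hlin hl
  · have := hl.varDim_eq (hu.iterate_src u.ty.dim)
    rw [Cell.dim_iterate_src] at this
    omega

/-- A proper identity has no linear variable. -/
theorem Cell.not_linear_ident {K : Ctx} {y : ℕ} {u : Cell} (hu : u.Typed K) (k : ℕ) :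
    ¬ (u.ident (k + 1)).tm.Linear K y := fun h => by
  have hd := h.varDim_eq (hu.ident (k + 1))
  rw [Cell.dim_ident hu] at hd
  rw [Cell.ident, Tm.Linear] at h
  refine Subst.LinearNone.not_linearOnce (linearNone_globeSubst hu (by omega) fun hl => ?_) h.2
  have := hl.varDim_eq hu
  omega

/-- If `u` has no linear variable `y`, then `y` is linear in `u ∗ v` exactly when it is in `v`: all
other terms of the substitution defining `u ∗ v` have a smaller dimension. -/
theorem Composable.linear_comp {K : Ctx} {d n y : ℕ} {u v : Cell} (h : Composable K d n u v)
    (hu : ¬ u.tm.Linear K y) : (Cell.comp d n u v).tm.Linear K y ↔ v.tm.Linear K y := by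
  by_cases hy : K.varDim y = d
  · obtain ⟨m, hm⟩ : ∃ m, d - n = m + 1 := ⟨d - n - 1, by have := h.lt; omega⟩
    have hvd := h.dim_right
    have hdu : (globeSubst d u).LinearNone K y := by
      have := linearNone_globeSubst h.left (by rw [h.dim_left, hy]) hu
      rwa [h.dim_left] at this
    have hs : ¬ v.src.tm.Linear K y := fun hl => by
      have := hl.varDim_eq h.right.src; rw [Cell.dim_src] at this; have := h.lt; omega
    have ht : ¬ v.tgt.tm.Linear K y := fun hl => by
      have := hl.varDim_eq h.right.tgt; rw [Cell.dim_tgt] at this; have := h.lt; omega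
    have hnone : (((globeSubst d u).pushCell m v.src).push v.tgt.tm).LinearNone K y :=
      ⟨hdu.pushCell m h.right.src (by rw [Cell.dim_src]; omega)
        (by rw [Cell.dim_src]; omega) hs, ht⟩
    have hB : K.varDim y = (compTy n (d - n - 1)).dim := by
      rw [dim_compTy]; have := h.lt; omega
    rw [Cell.comp, Tm.Linear, and_iff_right hB, glueSubst, hm, Subst.pushCell, Subst.push, Subst.LinearOnce]
    simp [hnone, hnone.not_linearOnce]
  · refine iff_of_false (fun hl => hy ?_) (fun hl => hy ?_)
    · rw [hl.varDim_eq h.typed, Cell.dim_comp h.lt]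
    · rw [hl.varDim_eq h.right, h.dim_right]


/-! ### Globular contexts -/

mutual
theorem GSetCtx.isCtx : ∀ {Γ : Ctx}, GSetCtx Γ → IsCtx Γ
  | _, .ec => .ec
  | _, .ce hA hx => .ce hA.isTy hx
theorem GSetTy.isTy : ∀ {Γ : Ctx} {A : Ty}, GSetTy Γ A → IsTy Γ A
  | _, _, .ob h => .ob h.isCtx
  | _, _, .arr hs ht => .arr hs.isTm ht.isTm
theorem GSetTm.isTm : ∀ {Γ : Ctx} {t : Tm} {A : Ty}, GSetTm Γ t A → IsTm Γ t A
  | _, _, _, .var h hx => .var h.isCtx hx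
end

theorem GSetTm.gsetCtx {Γ : Ctx} {t : Tm} {A : Ty} : GSetTm Γ t A → GSetCtx Γ
  | .var h _ => h

theorem GSetTy.gsetCtx {Γ : Ctx} {A : Ty} : GSetTy Γ A → GSetCtx Γ
  | .ob h => h
  | .arr hs _ => hs.gsetCtx

mutual
theorem GSetTy.weaken {Δ : Ctx} (hΔ : GSetCtx Δ) : ∀ {Γ : Ctx} {A : Ty}, GSetTy Γ A →
    (∀ x B, Γ.Mem x B → Δ.Mem x B) → GSetTy Δ A
  | _, _, .ob _, _ => .ob hΔ
  | _, _, .arr hs ht, h => .arr (hs.weaken hΔ h) (ht.weaken hΔ h)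
theorem GSetTm.weaken {Δ : Ctx} (hΔ : GSetCtx Δ) : ∀ {Γ : Ctx} {t : Tm} {A : Ty}, GSetTm Γ t A →
    (∀ x B, Γ.Mem x B → Δ.Mem x B) → GSetTm Δ t A
  | _, _, _, .var _ hx, h => .var hΔ (h _ _ hx)
end

theorem GSetCtx.gsetTy_of_mem : ∀ {Γ : Ctx}, GSetCtx Γ → ∀ {x : ℕ} {A : Ty}, Γ.Mem x A →
    GSetTy Γ A
  | _, .ec, _, _, h => h.elim
  | _, .ce hA hx, _, _, h => by
      rcases h with ⟨_, rfl⟩ | h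
      · exact hA.weaken (.ce hA hx) fun _ _ => .inr
      · exact (GSetCtx.gsetTy_of_mem hA.gsetCtx h).weaken (.ce hA hx) fun _ _ => .inr

theorem GSetTm.gsetTy {Γ : Ctx} {t : Tm} {A : Ty} : GSetTm Γ t A → GSetTy Γ A
  | .var h hx => h.gsetTy_of_mem hx

/-! ### Composites of projections -/

/-- The context `K` contains the globular context `Γ`, the apex `c` and, for each variable `x` of `Γ`,
the projection `p x : T x` of the expected type. The order of the declarations is not prescribed. -/
structure ContainsCone (K Γ : Ctx) (c : ℕ) (p : ℕ → ℕ) (T : ℕ → Ty) : Prop where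
  isCtx : IsCtx K
  globular : GSetCtx Γ
  mem : ∀ {x A}, Γ.Mem x A → K.Mem x A
  mem_apex : K.Mem c .ob
  ty_eq : ∀ {x A}, Γ.Mem x A → T x = projTy c p T x A
  mem_proj : ∀ {x A}, Γ.Mem x A → K.Mem (p x) (T x)

/-- A cell of `K` whose boundary consists of variables of `Γ`. -/
structure Cell.BoundaryIn (K Γ : Ctx) (x : Cell) : Prop where
  typed : x.Typed K
  ty : GSetTy Γ x.ty

theorem Cell.BoundaryIn.src {K Γ : Ctx} : ∀ {x : Cell}, x.BoundaryIn K Γ → 0 < x.ty.dim →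
    GSetTm Γ x.src.tm x.src.ty
  | ⟨_, .ob⟩, _, h => by simp [Ty.dim] at h
  | ⟨_, .arr _ _ _⟩, h, _ => by
      cases h.ty with
      | arr hs ht => exact hs

theorem Cell.BoundaryIn.tgt {K Γ : Ctx} : ∀ {x : Cell}, x.BoundaryIn K Γ → 0 < x.ty.dim →
    GSetTm Γ x.tgt.tm x.tgt.ty
  | ⟨_, .ob⟩, _, h => by simp [Ty.dim] at h
  | ⟨_, .arr _ _ _⟩, h, _ => by
      cases h.ty with
      | arr hs ht => exact ht

theorem GSetTm.iterate_src {Γ : Ctx} {x : Cell} (h : GSetTm Γ x.tm x.ty) (j : ℕ) :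
    GSetTm Γ (Cell.src^[j] x).tm (Cell.src^[j] x).ty := by
  induction j generalizing x with
  | zero => exact h
  | succ j ih =>
    refine ih ?_
    obtain ⟨t, _ | _⟩ := x
    · exact h
    · cases h.gsetTy with
      | arr hs _ => exact hs

theorem Cell.BoundaryIn.iterate_src {K Γ : Ctx} {x : Cell} (h : x.BoundaryIn K Γ) {j : ℕ}
    (hj : 0 < j) (hd : 0 < x.ty.dim) : GSetTm Γ (Cell.src^[j] x).tm (Cell.src^[j] x).ty := by
  obtain ⟨j, rfl⟩ : ∃ i, j = i + 1 := ⟨j - 1, by omega⟩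
  exact (h.src hd).iterate_src j

/-- The composite `coneTower` with `k` compositions, over a cell `x` of any dimension. -/
abbrev tower (p : ℕ → ℕ) (T : ℕ → Ty) (x : Cell) (k : ℕ) : Cell := coneTower p T x.ty.dim x k

/-- The projection of a cell which is a variable. -/
abbrev proj (p : ℕ → ℕ) (T : ℕ → Ty) (x : Cell) : Cell := projCell p T x.tm

theorem dim_tower {p : ℕ → ℕ} {T : ℕ → Ty} {x : Cell} {k : ℕ} (hk : k ≤ x.ty.dim) :
    (tower p T x k).ty.dim = x.ty.dim := by
  cases k with
  | zero => rfl
  | succ k => exact Cell.dim_comp (by omega) _ _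

/-- The recursion for the towers, with the iterated unit `1^d` unfolded to a number of identities. -/
theorem tower_succ_eq {p : ℕ → ℕ} {T : ℕ → Ty} {x : Cell} {k : ℕ}
    (hP : (proj p T (Cell.src^[x.ty.dim - k] x)).ty.dim = k + 1) :
    tower p T x (k + 1) = Cell.comp x.ty.dim k
      ((proj p T (Cell.src^[x.ty.dim - k] x)).ident (x.ty.dim - (k + 1))) (tower p T x k) := by
  rw [tower, coneTower, Cell.identTo, hP]

/-- The main properties of the towers with `k` compositions: they are well typed, and their
boundaries are towers over the boundary, except that the full tower has the type of the projection
of the target. -/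
structure TowerSpec (K Γ : Ctx) (p : ℕ → ℕ) (T : ℕ → Ty) (k : ℕ) (x : Cell) :
    Prop where
  typed : (tower p T x k).Typed K
  src : k < x.ty.dim → (tower p T x k).src = tower p T x.src k
  tgt : k < x.ty.dim → (tower p T x k).tgt = tower p T x.tgt k
  ty : 0 < k → k = x.ty.dim → (tower p T x k).ty = (proj p T x.tgt).ty

namespace ContainsCone
variable {K Γ : Ctx} {c : ℕ} {p : ℕ → ℕ} {T : ℕ → Ty} (H : ContainsCone K Γ c p T)
include H

theorem boundaryIn {x : Cell} (hx : GSetTm Γ x.tm x.ty) : x.BoundaryIn K Γ :=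
  ⟨hx.isTm.weaken H.isCtx fun _ _ => H.mem, hx.gsetTy⟩

theorem typed_proj {x : Cell} (hx : GSetTm Γ x.tm x.ty) : (proj p T x).Typed K := by
  obtain ⟨t, A⟩ := x
  cases hx with
  | var _ h => exact .var H.isCtx (H.mem_proj h)

theorem ty_proj_zero {x : Cell} (hx : GSetTm Γ x.tm x.ty) (hd : x.ty.dim = 0) :
    (proj p T x).ty = .arr .ob (.var c) x.tm := by
  obtain ⟨t, A⟩ := x
  cases hx with
  | @var _ x A hΓ h =>
  cases A with
  | ob => exact H.ty_eq h
  | arr => simp [Ty.dim] at hd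

theorem ty_proj_pos {x : Cell} (hx : GSetTm Γ x.tm x.ty) (hd : 0 < x.ty.dim) :
    (proj p T x).ty = .arr (proj p T x.tgt).ty (proj p T x.tgt).tm (tower p T x x.ty.dim).tm := by
  obtain ⟨t, A⟩ := x
  cases hx with
  | @var _ x A hΓ h =>
  cases A with
  | ob => simp [Ty.dim] at hd
  | arr => exact H.ty_eq h

/-- The tower is the target of the projection, once its type is known to be the one of the
projection of the target. -/
theorem tgt_proj_of_ty {x : Cell} (hx : GSetTm Γ x.tm x.ty)
    (h : 0 < x.ty.dim → (tower p T x x.ty.dim).ty = (proj p T x.tgt).ty) :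
    (proj p T x).tgt = tower p T x x.ty.dim := by
  rcases Nat.eq_zero_or_pos x.ty.dim with h0 | hpos
  · have hty := H.ty_proj_zero hx h0
    rw [tower, h0, coneTower]
    generalize proj p T x = P at *
    obtain ⟨t, A⟩ := P
    subst hty
    obtain ⟨t, _ | _⟩ := x
    · rfl
    · simp [Ty.dim] at h0
  · have hty := H.ty_proj_pos hx hpos
    rw [← h hpos] at hty
    generalize proj p T x = P at *
    obtain ⟨t, A⟩ := P
    subst hty
    rfl

/-- The projection of a cell has one dimension more, once the full tower over the cell is known to
have the type of the projection of the target. -/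
theorem dim_proj_of_ty {x : Cell} (hx : GSetTm Γ x.tm x.ty)
    (h : 0 < x.ty.dim → (tower p T x x.ty.dim).ty = (proj p T x.tgt).ty) :
    (proj p T x).ty.dim = x.ty.dim + 1 := by
  rcases Nat.eq_zero_or_pos x.ty.dim with h0 | hpos
  · rw [H.ty_proj_zero hx h0, h0]; rfl
  · rw [H.ty_proj_pos hx hpos, Ty.dim, ← h hpos, dim_tower le_rfl]

omit H in
theorem iterate_src_tower {k : ℕ}
    (h : ∀ {x : Cell}, x.BoundaryIn K Γ → k ≤ x.ty.dim → TowerSpec K Γ p T k x)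
    (hm : ∀ {x : Cell}, GSetTm Γ x.tm x.ty → x.BoundaryIn K Γ)
    {x : Cell} (hx : x.BoundaryIn K Γ) {j : ℕ} (hj : k + j ≤ x.ty.dim) :
    Cell.src^[j] (tower p T x k) = tower p T (Cell.src^[j] x) k := by
  induction j generalizing x with
  | zero => rfl
  | succ j ih =>
    rw [Function.iterate_succ_apply, (h hx (by omega)).src (by omega),
      ih (hm (hx.src (by omega))) (by rw [Cell.dim_src]; omega)]
    rfl

/-- The two cells composed in the last step of a tower are composable, because the projection of a
cell `y` has the tower over `y` as its target. -/
theorem composable_of_towerSpec {k : ℕ}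
    (h : ∀ {x : Cell}, x.BoundaryIn K Γ → k ≤ x.ty.dim → TowerSpec K Γ p T k x)
    {x : Cell} (hx : x.BoundaryIn K Γ) (hk : k < x.ty.dim) :
    Composable K x.ty.dim k ((proj p T (Cell.src^[x.ty.dim - k] x)).ident (x.ty.dim - (k + 1)))
      (tower p T x k) ∧
    (proj p T (Cell.src^[x.ty.dim - k] x)).ty.dim = k + 1 := by
  have hy := hx.iterate_src (j := x.ty.dim - k) (by omega) (by omega)
  have hyd : (Cell.src^[x.ty.dim - k] x).ty.dim = k := by rw [Cell.dim_iterate_src]; omega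
  have hst := iterate_src_tower h H.boundaryIn hx (j := x.ty.dim - k) (by omega)
  generalize Cell.src^[x.ty.dim - k] x = y at *
  have hty : 0 < y.ty.dim → (tower p T y y.ty.dim).ty = (proj p T y.tgt).ty := fun h0 => by
    have := (h (H.boundaryIn hy) hyd.ge).ty (by omega) hyd.symm
    rwa [hyd]
  have hP := H.typed_proj hy
  have hPd := H.dim_proj_of_ty hy hty
  rw [hyd] at hPd
  refine ⟨⟨hk, hP.ident _, (h hx hk.le).typed, ?_, dim_tower hk.le, ?_⟩, hPd⟩
  · rw [Cell.dim_ident hP, hPd]; omega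
  · rw [hst, show x.ty.dim - k = (x.ty.dim - (k + 1)) + 1 by omega, Function.iterate_succ_apply',
      Cell.iterate_tgt_ident hP, H.tgt_proj_of_ty hy hty, hyd]

theorem towerSpec (k : ℕ) : ∀ {x : Cell}, x.BoundaryIn K Γ → k ≤ x.ty.dim →
    TowerSpec K Γ p T k x := by
  induction k with
  | zero => exact fun hx _ => ⟨hx.typed, fun _ => rfl, fun _ => rfl, fun h => absurd h (by omega)⟩
  | succ k ih =>
    intro x hx hk
    obtain ⟨hc, hPd⟩ := H.composable_of_towerSpec ih hx (by omega)
    have htw := tower_succ_eq hPd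
    have hP := H.typed_proj (hx.iterate_src (j := x.ty.dim - k) (by omega) (by omega))
    have IH := ih hx (by omega)
    refine ⟨htw ▸ hc.typed, fun h => ?_, fun h => ?_, fun _ h => ?_⟩
    · obtain ⟨d, hd⟩ : ∃ d, x.ty.dim = d + 1 := ⟨x.ty.dim - 1, by omega⟩
      have hd' : x.src.ty.dim = d := by rw [Cell.dim_src, hd]; rfl
      have hs : Cell.src^[x.src.ty.dim - k] x.src = Cell.src^[x.ty.dim - k] x := by
        rw [hd', hd, show d + 1 - k = d - k + 1 by omega]; rfl
      rw [htw, tower_succ_eq (by rw [hs]; exact hPd), hs, hd', ← IH.src (by omega)]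
      rw [hd] at hc
      rw [hd, hc.src_comp (by omega), show d + 1 - (k + 1) = d - (k + 1) + 1 by omega,
        show d + 1 - k = d - k + 1 by omega]
      rw [Cell.src_ident (by rwa [hd, show d + 1 - k = d - k + 1 by omega] at hP)]
    · obtain ⟨d, hd⟩ : ∃ d, x.ty.dim = d + 1 := ⟨x.ty.dim - 1, by omega⟩
      have hd' : x.tgt.ty.dim = d := by rw [Cell.dim_tgt, hd]; rfl
      have hs : Cell.src^[x.tgt.ty.dim - k] x.tgt = Cell.src^[x.ty.dim - k] x := by
        rw [hd', hd, show d + 1 - k = d - (k + 1) + 1 + 1 by omega,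
          show d - k = d - (k + 1) + 1 by omega, Function.iterate_succ_apply,
          Function.iterate_succ_apply, Function.iterate_succ_apply, Cell.src_tgt_eq (by omega)]
      rw [htw, tower_succ_eq (by rw [hs]; exact hPd), hs, hd', ← IH.tgt (by omega)]
      rw [hd] at hc
      rw [hd, hc.tgt_comp (by omega), show d + 1 - (k + 1) = d - (k + 1) + 1 by omega,
        show d + 1 - k = d - k + 1 by omega]
      rw [Cell.tgt_ident (by rwa [hd, show d + 1 - k = d - k + 1 by omega] at hP)]
    · rw [htw]
      rw [← h, show k + 1 - k = 1 by omega, show k + 1 - (k + 1) = 0 by omega] at hc ⊢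
      rw [hc.ty_comp_top, IH.tgt (by omega)]
      simp only [Function.iterate_one, Cell.ident] at hPd ⊢
      have hy := hx.src (by omega)
      have hz := hx.tgt (by omega)
      have hyd : x.src.ty.dim = k := by rw [Cell.dim_src]; omega
      have hzd : x.tgt.ty.dim = k := by rw [Cell.dim_tgt]; omega
      rcases Nat.eq_zero_or_pos k with h0 | hpos
      · have hty := H.ty_proj_zero hy (hyd.trans h0)
        rw [H.ty_proj_zero hz (hzd.trans h0)]
        generalize proj p T x.src = P at *
        obtain ⟨t, A⟩ := P
        subst hty
        rw [h0]
        rfl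
      · have hty := H.ty_proj_pos hy (by omega)
        rw [H.ty_proj_pos hz (by omega), hzd, ← Cell.tgt_src_eq (by omega)]
        generalize proj p T x.src = P at *
        obtain ⟨t, A⟩ := P
        subst hty
        rfl

section
variable {x : Cell}

theorem composable_tower (hx : x.BoundaryIn K Γ) {k : ℕ} (hk : k < x.ty.dim) :
    Composable K x.ty.dim k ((proj p T (Cell.src^[x.ty.dim - k] x)).ident (x.ty.dim - (k + 1)))
      (tower p T x k) :=
  (H.composable_of_towerSpec (H.towerSpec k) hx hk).1

theorem tower_succ (hx : x.BoundaryIn K Γ) {k : ℕ} (hk : k < x.ty.dim) :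
    tower p T x (k + 1) = Cell.comp x.ty.dim k
      ((proj p T (Cell.src^[x.ty.dim - k] x)).ident (x.ty.dim - (k + 1))) (tower p T x k) :=
  tower_succ_eq (H.composable_of_towerSpec (H.towerSpec k) hx hk).2

/-- The type of the projection of a cell is well formed. -/
theorem isTy_projTy {y : ℕ} {A : Ty} (hx : Cell.BoundaryIn K Γ ⟨.var y, A⟩) :
    IsTy K (projTy c p T y A) := by
  cases A with
  | ob => exact .arr (.var H.isCtx H.mem_apex) hx.typed
  | arr A s t =>
    have h := H.towerSpec _ hx le_rfl
    have hty := h.ty (by simp [Ty.dim]) rfl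
    exact .arr (H.typed_proj (hx.tgt (by simp [Ty.dim]))) (hty ▸ h.typed)

/-! ### Variables of the towers -/

theorem fv_tower_succ (hx : x.BoundaryIn K Γ) {k : ℕ} (hk : k < x.ty.dim) :
    (tower p T x (k + 1)).fv =
      (proj p T (Cell.src^[x.ty.dim - k] x)).fv ∪ (tower p T x k).fv := by
  rw [H.tower_succ hx hk, (H.composable_tower hx hk).fv_comp, Cell.fv_ident]
  exact H.typed_proj (hx.iterate_src (by omega) (by omega))

theorem fv_tower_tm (hx : x.BoundaryIn K Γ) {k : ℕ} (hk : k ≤ x.ty.dim) (h0 : 0 < k) :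
    (tower p T x k).tm.fv = (tower p T x k).fv := by
  obtain ⟨k, rfl⟩ : ∃ j, k = j + 1 := ⟨k - 1, by omega⟩
  rw [H.tower_succ hx hk, (H.composable_tower hx hk).fv_comp,
    (H.composable_tower hx hk).fv_comp_tm]

theorem fv_subset_tower (hx : x.BoundaryIn K Γ) {k : ℕ} (hk : k ≤ x.ty.dim) :
    x.fv ⊆ (tower p T x k).fv := by
  induction k with
  | zero => rfl
  | succ k ih =>
    rw [H.fv_tower_succ hx hk]
    exact (ih (by omega)).trans Finset.subset_union_right

theorem fv_proj_subset_tower (hx : x.BoundaryIn K Γ) (h : 0 < x.ty.dim) :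
    (proj p T x.src).fv ⊆ (tower p T x x.ty.dim).fv := by
  obtain ⟨k, hk⟩ : ∃ k, x.ty.dim = k + 1 := ⟨x.ty.dim - 1, by omega⟩
  rw [hk, H.fv_tower_succ hx (by omega), hk, show k + 1 - k = 1 by omega]
  exact Finset.subset_union_left

theorem fv_proj_eq (hx : GSetTm Γ x.tm x.ty) (h : 0 < x.ty.dim) :
    (proj p T x).fv = (proj p T x).tm.fv ∪ (proj p T x.tgt).fv ∪ (tower p T x x.ty.dim).fv := by
  rw [Cell.fv, H.ty_proj_pos hx h, Ty.fv, H.fv_tower_tm (H.boundaryIn hx) le_rfl h]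
  ext y; simp only [Cell.fv, Finset.mem_union]; tauto

theorem fv_proj_src_subset (hx : GSetTm Γ x.tm x.ty) : (proj p T x.src).fv ⊆ (proj p T x).fv := by
  rcases Nat.eq_zero_or_pos x.ty.dim with h | h
  · obtain ⟨t, _ | _⟩ := x
    · rfl
    · simp [Ty.dim] at h
  · rw [H.fv_proj_eq hx h]
    exact (H.fv_proj_subset_tower (H.boundaryIn hx) h).trans Finset.subset_union_right

theorem fv_proj_tgt_subset (hx : GSetTm Γ x.tm x.ty) : (proj p T x.tgt).fv ⊆ (proj p T x).fv := by
  rcases Nat.eq_zero_or_pos x.ty.dim with h | h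
  · obtain ⟨t, _ | _⟩ := x
    · rfl
    · simp [Ty.dim] at h
  · rw [H.fv_proj_eq hx h]
    exact Finset.subset_union_right.trans Finset.subset_union_left

/-- All projections occurring in a tower over `x` are projections of iterated sources of `x`, whose
variables already occur in the projection of `σ(x)`. -/
theorem fv_tower_subset (hx : x.BoundaryIn K Γ) {k : ℕ} (hk : k ≤ x.ty.dim) :
    (tower p T x k).fv ⊆ x.fv ∪ (proj p T x.src).fv := by
  induction k with
  | zero => exact Finset.subset_union_left
  | succ k ih =>
    rw [H.fv_tower_succ hx hk]
    refine Finset.union_subset (Finset.Subset.trans ?_ Finset.subset_union_right) (ih (by omega))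
    have hy := hx.src (by omega)
    rw [show x.ty.dim - k = (x.ty.dim - (k + 1)) + 1 by omega, Function.iterate_succ_apply]
    generalize x.ty.dim - (k + 1) = j
    induction j with
    | zero => rfl
    | succ j ihj =>
      rw [Function.iterate_succ_apply']
      exact (H.fv_proj_src_subset (hy.iterate_src j)).trans ihj

/-- The variables of the target of the projection of a cell `x`. -/
theorem fv_tower (hx : x.BoundaryIn K Γ) (h : 0 < x.ty.dim) :
    (tower p T x x.ty.dim).fv = x.fv ∪ (proj p T x.src).fv :=
  (H.fv_tower_subset hx le_rfl).antisymm
    (Finset.union_subset (H.fv_subset_tower hx le_rfl) (H.fv_proj_subset_tower hx h))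

/-- The only variable of `K`, projections excluded, which is linear in a tower over `x` is `x`. -/
theorem linear_tower (hx : x.BoundaryIn K Γ) {k : ℕ} (hk : k ≤ x.ty.dim) {y : ℕ}
    (hy : ∀ z, y ≠ p z) : (tower p T x k).tm.Linear K y ↔ x.tm.Linear K y := by
  induction k with
  | zero => rfl
  | succ k ih =>
    rw [H.tower_succ hx hk, (H.composable_tower hx hk).linear_comp, ih (by omega)]
    have hs := hx.iterate_src (j := x.ty.dim - k) (by omega) (by omega)
    rcases Nat.eq_zero_or_pos (x.ty.dim - (k + 1)) with h0 | hpos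
    · -- The last composition involves the projection itself, which is a variable other than `y`.
      rw [h0]
      generalize Cell.src^[x.ty.dim - k] x = w at *
      obtain ⟨t, A⟩ := w
      cases hs with
      | var _ _ => exact hy _
    · obtain ⟨j, hj⟩ : ∃ j, x.ty.dim - (k + 1) = j + 1 := ⟨x.ty.dim - (k + 1) - 1, by omega⟩
      rw [hj]
      exact Cell.not_linear_ident (H.typed_proj hs) j

end

end ContainsCone

/-! ### Variables of the projections -/

theorem Ctx.mem_projections {p : ℕ → ℕ} {T : ℕ → Ty} {q : ℕ} {B : Ty} : ∀ {Γ : Ctx},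
    (Γ.projections p T).Mem q B ↔ ∃ x A, Γ.Mem x A ∧ q = p x ∧ B = T x
  | .nil => by simp [Ctx.projections, Ctx.Mem]
  | .snoc Γ y A => by
      simp only [Ctx.projections, Ctx.Mem, Ctx.mem_projections (Γ := Γ)]
      constructor
      · rintro (⟨rfl, rfl⟩ | ⟨x, A, h, h'⟩)
        · exact ⟨y, A, .inl ⟨rfl, rfl⟩, rfl, rfl⟩
        · exact ⟨x, A, .inr h, h'⟩
      · rintro ⟨x, A, ⟨rfl, rfl⟩ | h, h'⟩
        · exact .inl h'
        · exact .inr ⟨x, A, h, h'⟩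

theorem projFv_empty (K P : Ctx) : projFv K P ∅ = ∅ := by
  simp [projFv]

namespace ContainsCone
variable {K Γ : Ctx} {c : ℕ} {p : ℕ → ℕ} {T : ℕ → Ty} (H : ContainsCone K Γ c p T)
include H

/-- The target of a projection is a full tower. -/
theorem exists_eq_arr_tower {x : ℕ} {A : Ty} (h : Γ.Mem x A) :
    ∃ B s, T x = .arr B s (tower p T ⟨.var x, A⟩ A.dim).tm := by
  rw [H.ty_eq h]
  cases A with
  | ob => exact ⟨_, _, rfl⟩
  | arr => exact ⟨_, _, rfl⟩

theorem linear_tower_var {x y : ℕ} {A : Ty} (hx : Cell.BoundaryIn K Γ ⟨.var x, A⟩)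
    (hy : ∀ z, y ≠ p z) : (tower p T ⟨.var x, A⟩ A.dim).tm.Linear K y ↔ y = x := by
  have := H.linear_tower hx le_rfl hy
  rwa [Tm.Linear] at this

/-- The projection of `x` involves the projections of all variables of `x` and of its boundary. -/
theorem fv_proj_subset_of_mem {x : Cell} (hx : GSetTm Γ x.tm x.ty) {y : ℕ} {B : Ty}
    (hy : y ∈ x.fv) : (proj p T ⟨.var y, B⟩).fv ⊆ (proj p T x).fv := by
  induction hd : x.ty.dim generalizing x with
  | zero =>
    obtain ⟨t, _ | _⟩ := x
    · cases hx
      simp only [Cell.fv, Tm.fv, Ty.fv, Finset.union_empty, Finset.mem_singleton] at hy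
      rw [hy]
    · simp [Ty.dim] at hd
  | succ d ih =>
    have hb := H.boundaryIn hx
    rw [Cell.fv_eq (by omega), Finset.mem_union, Finset.mem_union] at hy
    rcases hy with (hy | hy) | hy
    · exact (ih (hb.src (by omega)) hy (by rw [Cell.dim_src]; omega)).trans
        (H.fv_proj_src_subset hx)
    · exact (ih (hb.tgt (by omega)) (Finset.mem_union_left _ hy)
        (by rw [Cell.dim_tgt]; omega)).trans (H.fv_proj_tgt_subset hx)
    · obtain ⟨t, A⟩ := x
      cases hx
      rw [Tm.fv, Finset.mem_singleton] at hy
      rw [hy]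

theorem apex_mem_fv_proj {x : Cell} (hx : GSetTm Γ x.tm x.ty) : c ∈ (proj p T x).fv := by
  induction hd : x.ty.dim generalizing x with
  | zero =>
    rw [Cell.fv, H.ty_proj_zero hx hd]
    simp [Ty.fv, Tm.fv]
  | succ d ih =>
    exact H.fv_proj_tgt_subset hx
      (ih ((H.boundaryIn hx).tgt (by omega)) (by rw [Cell.dim_tgt]; omega))

/-- The set `P_Π(FV(x : A))` consists of the variables of the projection of `x`. -/
theorem projFv_eq (hp : ∀ y ∈ Γ.fv, ∀ z, y ≠ p z) {x : Cell} (hx : GSetTm Γ x.tm x.ty) :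
    projFv K (Γ.projections p T) x.fv = ((proj p T x).fv : Set ℕ) := by
  have hxΓ : x.fv ⊆ Γ.fv := Cell.Typed.fv_subset hx.isTm
  ext v
  simp only [projFv, Set.mem_ofPred_eq, Finset.mem_coe]
  constructor
  · rintro ⟨q, B, s, t, y, hq, hy, hlin, hv⟩
    obtain ⟨z, A, hz, rfl, hT⟩ := Ctx.mem_projections.1 hq
    obtain ⟨B', s', hT'⟩ := H.exists_eq_arr_tower hz
    rw [hT'] at hT
    obtain ⟨-, -, rfl⟩ := Ty.arr.inj hT
    have hyz : y = z :=
      (H.linear_tower_var (H.boundaryIn (.var H.globular hz)) (hp y (hxΓ hy))).1 hlin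
    rw [hT, ← hT'] at hv
    subst hyz
    exact H.fv_proj_subset_of_mem hx (B := A) hy hv
  · intro hv
    obtain ⟨t, A⟩ := x
    cases hx with
    | @var _ y A hΓ h =>
    obtain ⟨B, s, hT⟩ := H.exists_eq_arr_tower h
    have hy : y ∈ Cell.fv ⟨.var y, A⟩ := by simp [Cell.fv, Tm.fv]
    refine ⟨p y, B, s, _, y, Ctx.mem_projections.2 ⟨y, A, h, rfl, hT.symm⟩, hy,
      (H.linear_tower_var (H.boundaryIn (.var hΓ h)) (hp y (hxΓ hy))).2 rfl, ?_⟩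
    rw [← hT]
    exact hv

/-- The type of a projection satisfies the side conditions of the rule (KE). -/
theorem cond_projTy (hp : ∀ y ∈ Γ.fv, ∀ z, y ≠ p z) {x : ℕ} {X : Ty}
    (hx : Cell.BoundaryIn K Γ ⟨.var x, X⟩) (hxp : ∀ z, x ≠ p z) :
    ∃ A s t, projTy c p T x X = .arr A s t ∧ TauBarCond K s A X c (Γ.projections p T) ∧
      SigmaCond K t A x X (Γ.projections p T) := by
  have hty := H.isTy_projTy hx
  have hlin := (H.linear_tower_var hx hxp).2 rfl
  cases X with
  | ob =>
    cases hty with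
    | arr hs ht =>
      refine ⟨_, _, _, rfl, ⟨hs, ?_⟩, ht, ?_, hlin⟩
      · simp [Ty.tgtFv, projFv_empty, Tm.fv, Ty.fv]
      · simp [Ty.srcFv, projFv_empty, Tm.fv, Ty.fv]
  | arr A a b =>
    have hpos : 0 < (Ty.arr A a b).dim := by simp [Ty.dim]
    cases hty with
    | arr hs ht =>
      refine ⟨_, _, _, rfl, ⟨hs, ?_⟩, ht, ?_, hlin⟩
      · have h₁ := H.projFv_eq hp (hx.tgt hpos)
        have h₂ := H.apex_mem_fv_proj (hx.tgt hpos)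
        refine Eq.trans ?_ (congrArg ({c} ∪ ·) h₁.symm)
        rw [Set.singleton_union, Set.insert_eq_of_mem h₂]
        rfl
      · have h₁ := H.projFv_eq hp (hx.src hpos)
        have h₂ := (H.towerSpec _ hx le_rfl).ty hpos rfl
        have h₃ := H.fv_tower hx hpos
        rw [Cell.fv, h₂] at h₃
        refine (congrArg (fun s : Finset ℕ => (s : Set ℕ)) h₃).trans ?_
        rw [Finset.coe_union, ← h₁]
        rfl

end ContainsCone

/-! ### Construction of the cone -/

theorem Ctx.mem_append {Γ : Ctx} {x : ℕ} {A : Ty} : ∀ {Δ : Ctx},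
    (Γ.append Δ).Mem x A ↔ Γ.Mem x A ∨ Δ.Mem x A
  | .nil => by simp [Ctx.append, Ctx.Mem]
  | .snoc Δ y B => by simp only [Ctx.append, Ctx.Mem, Ctx.mem_append (Δ := Δ)]; tauto

theorem Ctx.fv_append (Γ : Ctx) : ∀ Δ : Ctx, (Γ.append Δ).fv = Γ.fv ∪ Δ.fv
  | .nil => by simp [Ctx.append, Ctx.fv]
  | .snoc Δ x A => by simp [Ctx.append, Ctx.fv, Ctx.fv_append Γ Δ]

theorem Ctx.fv_projections (p : ℕ → ℕ) (T : ℕ → Ty) : ∀ Γ : Ctx,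
    (Γ.projections p T).fv = Γ.fv.image p
  | .nil => rfl
  | .snoc Γ x A => by
      rw [Ctx.projections, Ctx.fv, Ctx.fv, Finset.image_union, Ctx.fv_projections p T Γ,
        Finset.image_singleton]

theorem Ctx.projections_congr {p : ℕ → ℕ} {T T' : ℕ → Ty} : ∀ {Γ : Ctx},
    (∀ x ∈ Γ.fv, T x = T' x) → Γ.projections p T = Γ.projections p T'
  | .nil, _ => rfl
  | .snoc Γ x A, h => by
      rw [Ctx.projections, Ctx.projections, h x (by simp [Ctx.fv]),
        Ctx.projections_congr fun y hy => h y (Γ.fv_subset_snoc x A hy)]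

/-- Only the types of projections of variables of `Γ` matter for cells of `Γ`. -/
theorem proj_congr {Γ : Ctx} {p : ℕ → ℕ} {T T' : ℕ → Ty} (hT : ∀ x ∈ Γ.fv, T x = T' x)
    {x : Cell} (hx : GSetTm Γ x.tm x.ty) : proj p T x = proj p T' x := by
  obtain ⟨t, A⟩ := x
  cases hx with
  | @var _ y _ _ h => simp only [proj, projCell, hT y h.mem_fv]

theorem tower_congr {K Γ : Ctx} {p : ℕ → ℕ} {T T' : ℕ → Ty} (hT : ∀ x ∈ Γ.fv, T x = T' x)
    {x : Cell} (hx : x.BoundaryIn K Γ) {k : ℕ} (hk : k ≤ x.ty.dim) :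
    tower p T x k = tower p T' x k := by
  induction k with
  | zero => rfl
  | succ k ih =>
    have h := proj_congr (p := p) hT (hx.iterate_src (j := x.ty.dim - k) (by omega) (by omega))
    have ih := ih (by omega)
    simp only [tower, proj] at h ih ⊢
    rw [coneTower, coneTower, h, ih]

theorem projTy_congr {K Γ : Ctx} {c x : ℕ} {A : Ty} {p : ℕ → ℕ} {T T' : ℕ → Ty}
    (hT : ∀ x ∈ Γ.fv, T x = T' x) (hx : Cell.BoundaryIn K Γ ⟨.var x, A⟩) :
    projTy c p T x A = projTy c p T' x A := by
  cases A with
  | ob => rfl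
  | arr A s t =>
    have h₁ := proj_congr (p := p) hT (hx.tgt (by simp [Ty.dim]))
    have h₂ := tower_congr (p := p) hT hx le_rfl
    simp only [tower, proj, Cell.tgt] at h₁ h₂
    simp only [projTy]
    rw [h₁]
    exact congrArg (fun u : Cell => Ty.arr _ _ u.tm) h₂

/-- A declaration may be inserted in the middle of a context. -/
theorem IsCtx.insert {Γ : Ctx} {x c : ℕ} {X : Ty} (hX : IsTy Γ X) : ∀ {P : Ctx},
    IsCtx ((Γ.snoc c .ob).append P) → x ∉ ((Γ.snoc c .ob).append P).fv →
    IsCtx (((Γ.snoc x X).snoc c .ob).append P)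
  | .nil, .ce _ hc, hx => by
      simp only [Ctx.append, Ctx.fv, Finset.mem_union, Finset.mem_singleton, not_or] at hx
      refine .ce (.ob (.ce hX hx.1)) ?_
      simp only [Ctx.fv, Finset.mem_union, Finset.mem_singleton, not_or]
      exact ⟨hc, Ne.symm hx.2⟩
  | .snoc P y B, .ce hB hy, hx => by
      have hx' : x ∉ ((Γ.snoc c .ob).append P).fv ∧ x ≠ y := by
        simpa [Ctx.append, Ctx.fv, and_comm] using hx
      refine .ce (hB.weaken (IsCtx.insert hX hB.isCtx hx'.1) fun z C h => ?_) ?_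
      · simp only [Ctx.mem_append, Ctx.Mem] at h ⊢
        tauto
      · simp only [Ctx.fv_append, Ctx.fv, Finset.mem_union, Finset.mem_singleton] at hy ⊢
        have := hx'.2.symm
        tauto

/-- Every globular context has a cone, for any choice of variables for the apex and the projections
above those of the context. In the induction step, the variable `x` is inserted before the apex, and
its projection is appended at the end. -/
theorem exists_cone {c : ℕ} {p : ℕ → ℕ} (hp : Function.Injective p) (hcp : ∀ x, c < p x) :
    ∀ {Γ : Ctx}, GSetCtx Γ → (∀ x ∈ Γ.fv, x < c) →
      ∃ T : ℕ → Ty, ContainsCone (Γ.cone c p T) Γ c p T ∧ Cone (Γ.cone c p T) Γ c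
  | .nil, hΓ, _ =>
      ⟨fun _ => .ob, ⟨.ce (.ob .ec) (by simp [Ctx.fv]), hΓ, fun h => h.elim, .inl ⟨rfl, rfl⟩,
        fun h => h.elim, fun h => h.elim⟩, .ek c⟩
  | .snoc Γ x X, hΓ, hc => by
      obtain ⟨hX, hxΓ⟩ : GSetTy Γ X ∧ x ∉ Γ.fv := by
        cases hΓ with
        | ce hX hx => exact ⟨hX, hx⟩
      have hxc : x < c := hc x (by simp [Ctx.fv])
      have hcΓ : ∀ y ∈ Γ.fv, y < c := fun y hy => hc y (Γ.fv_subset_snoc x X hy)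
      obtain ⟨T₀, H₀, hcone⟩ := exists_cone hp hcp hX.gsetCtx hcΓ
      have hbΓ : ∀ {y A}, Γ.Mem y A → Cell.BoundaryIn Γ Γ ⟨.var y, A⟩ := fun h =>
        ⟨.var hX.gsetCtx.isCtx h, hX.gsetCtx.gsetTy_of_mem h⟩
      have hbx : Cell.BoundaryIn (Γ.snoc x X) Γ ⟨.var x, X⟩ :=
        ⟨.var hΓ.isCtx (.inl ⟨rfl, rfl⟩), hX⟩
      obtain ⟨T, hT₀, hTx⟩ : ∃ T : ℕ → Ty, (∀ y ∈ Γ.fv, T₀ y = T y) ∧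
          T x = projTy c p T₀ x X := by
        refine ⟨Function.update T₀ x (projTy c p T₀ x X), fun y hy => ?_, by simp⟩
        rw [Function.update_of_ne]
        rintro rfl; exact hxΓ hy
      rw [projTy_congr hT₀ hbx] at hTx
      have hTΓ : ∀ {y A}, Γ.Mem y A → T y = projTy c p T y A := fun h => by
        rw [← hT₀ _ h.mem_fv, H₀.ty_eq h, projTy_congr hT₀ (hbΓ h)]
      have hKT : Γ.cone c p T₀ = Γ.cone c p T := by
        rw [Ctx.cone, Ctx.projections_congr hT₀, Ctx.cone]
      have hK₀ := H₀.isCtx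
      rw [hKT] at hK₀ hcone
      have hK : IsCtx (((Γ.snoc x X).snoc c .ob).append (Γ.projections p T)) := by
        refine IsCtx.insert hX.isTy hK₀ ?_
        simp only [Ctx.fv_append, Ctx.fv, Ctx.fv_projections, Finset.mem_union,
          Finset.mem_singleton, Finset.mem_image, not_or, not_exists, not_and]
        exact ⟨⟨hxΓ, hxc.ne⟩, fun z _ h => by have := hcp z; omega⟩
      have H : ContainsCone (((Γ.snoc x X).snoc c .ob).append (Γ.projections p T)) Γ c p T :=
        { isCtx := hK
          globular := hX.gsetCtx
          mem := fun h => Ctx.mem_append.2 (.inl (.inr (.inr h)))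
          mem_apex := Ctx.mem_append.2 (.inl (.inl ⟨rfl, rfl⟩))
          ty_eq := hTΓ
          mem_proj := fun h => Ctx.mem_append.2
            (.inr (Ctx.mem_projections.2 ⟨_, _, h, rfl, rfl⟩)) }
      have hbK : Cell.BoundaryIn (((Γ.snoc x X).snoc c .ob).append (Γ.projections p T)) Γ
          ⟨.var x, X⟩ :=
        ⟨.var hK (Ctx.mem_append.2 (.inl (.inr (.inl ⟨rfl, rfl⟩)))), hX⟩
      have hpK : p x ∉ (((Γ.snoc x X).snoc c .ob).append (Γ.projections p T)).fv := by
        have hpx := hcp x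
        simp only [Ctx.fv_append, Ctx.fv, Ctx.fv_projections, Finset.mem_union,
          Finset.mem_singleton, Finset.mem_image, not_or, not_exists, not_and]
        refine ⟨⟨⟨fun h => ?_, by omega⟩, by omega⟩, fun z hz h => hxΓ (hp h ▸ hz)⟩
        have := hcΓ _ h
        omega
      have hty := H.isTy_projTy hbK
      obtain ⟨A, s, t, hA, hτ, hσ⟩ := H.cond_projTy
        (fun y hy z => by have := hcΓ y hy; have := hcp z; omega) hbK
        (fun z => by have := hcp z; omega)
      have hctx : IsCtx ((Γ.snoc x X).cone c p T) := .ce (hTx ▸ hty) hpK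
      refine ⟨T, ⟨hctx, hΓ, ?_, ?_, ?_, ?_⟩, ?_⟩
      · exact fun h => Ctx.mem_append.2 (.inl (.inr h))
      · exact Ctx.mem_append.2 (.inl (.inl ⟨rfl, rfl⟩))
      · rintro y A (⟨rfl, rfl⟩ | h)
        · exact hTx
        · exact hTΓ h
      · exact fun h => Ctx.mem_append.2 (.inr (Ctx.mem_projections.2 ⟨_, _, h, rfl, rfl⟩))
      · have := Cone.ke hcone (hA ▸ hty) hτ hσ hpK
        rwa [← hA, ← hTx] at this

end CaTT

theorem mainTheorem1 (Γ : CaTT.Ctx) (hΓ : Γ.Globular) :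
    ∃ (c : ℕ) (p : ℕ → ℕ) (T : ℕ → CaTT.Ty),
      CaTT.IsCtx (Γ.cone c p T) ∧
      CaTT.Cone (Γ.cone c p T) Γ c ∧
      (∀ (x : ℕ) (A : CaTT.Ty), Γ.Mem x A → T x = CaTT.projTy c p T x A) ∧
      (∀ (x : ℕ) (A : CaTT.Ty), Γ.Mem x A →
        (((CaTT.Tm.var (p x)).fv ∪ (T x).fv : Finset ℕ) : Set ℕ) =
            CaTT.projFv (Γ.cone c p T) (Γ.projections p T) ((CaTT.Tm.var x).fv ∪ A.fv) ∧
          c ∈ (CaTT.Tm.var (p x)).fv ∪ (T x).fv ∧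
          ∃ (B : CaTT.Ty) (s t : CaTT.Tm), T x = .arr B s t ∧
            t.Linear (Γ.cone c p T) x ∧
            ∀ y ∈ Γ.fv, t.Linear (Γ.cone c p T) y → y = x) := by
  -- The apex and the projections are numbered above all variables of `Γ`.
  obtain ⟨c, hc⟩ : ∃ c, ∀ x ∈ Γ.fv, x < c :=
    ⟨Γ.fv.sup id + 1, fun x hx => Nat.lt_succ_of_le (Finset.le_sup (f := id) hx)⟩
  have hcp : ∀ x, c < x + c + 1 := fun x => by omega
  obtain ⟨T, H, hcone⟩ := CaTT.exists_cone (p := fun x => x + c + 1)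
    (fun x y h => by simpa using h) hcp hΓ hc
  have hp : ∀ y ∈ Γ.fv, ∀ z, y ≠ z + c + 1 := fun y hy z => by have := hc y hy; omega
  refine ⟨c, _, T, H.isCtx, hcone, fun x A h => H.ty_eq h, fun x A h => ?_⟩
  have hx : CaTT.GSetTm Γ (.var x) A := .var hΓ h
  obtain ⟨B, s, hT⟩ := H.exists_eq_arr_tower h
  have hlin := fun y hy => H.linear_tower_var (y := y) (H.boundaryIn (x := ⟨_, A⟩) hx) (hp y hy)
  exact ⟨(H.projFv_eq hp (x := ⟨_, A⟩) hx).symm, H.apex_mem_fv_proj (x := ⟨_, A⟩) hx,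
    B, s, _, hT, (hlin x h.mem_fv).2 rfl, fun y hy => (hlin y hy).1⟩
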